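/- Let $n\ge 1$, let $B=\{x\in\mathbb R^n:|x|<1\}$ be the open unit ball, let $\omega_n$ be the surface area of the unit sphere $\partial B$ (so $\omega_1=2$), let $\nu(x)=x$ be the outward unit normal at $x\in\partial B$, and let $$\Phi(x)=\begin{cases}\frac1{\omega_1}|x| & n=1,\\[2pt] \frac1{\omega_2}\log|x| & n=2,\\[2pt] -\frac1{(n-2)\,\omega_n\,|x|^{n-2}} & n>2.\end{cases}$$ For $z\in B$ consider the problem $$\Delta u=\delta_z-\frac n{\omega_n}\ \text{ in } B,\qquad \nabla u\cdot\nu=0\ \text{ on }\partial B. \tag{P}$$ Here a solution of (P) is a real function $u$ that is locally integrable in $B$ and satisfies $\int_B u\,\Delta\varphi\,dx=\varphi(z)-\frac n{\omega_n}\int_B\varphi\,dx$ for all $\varphi\in C_c^\infty(B)$, and that at every $x\in\partial B$ is defined and differentiable relative to the closed ball $\overline B$ with gradient satisfying $\nabla u(x)\cdot x=0$. Define $$G_z(x)=\Phi(x-z)+\frac1{\omega_n}\int_0^{|z|}\left(\frac{x\cdot\frac z{|z|}-\frac1s}{\left|s x-\frac z{|z|}\right|^n}+\frac1s\right)ds-\frac1{2\omega_n}|x|^2$$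 (for $z=0$ the integral is zero). Then for every $z\in B$: 1. the integral in the definition of $G_z(x)$ converges absolutely for every $x\in\overline B$, and $G_z$ is continuously differentiable on $\overline B\setminus\{z\}$ (up to the boundary); 2. $G_z$ is a solution of (P), and so is $G_z+c$ for every constant $c\in\mathbb R$ (which may depend on $z$); 3. conversely, if $u$ is any solution of (P), then there is a constant $c\in\mathbb R$ (which may depend on $z$) such that $u=G_z+c$ almost everywhere in $B$ and everywhere on $\partial B$. -/

import Mathlib

open MeasureTheory Metric
open scoped Distributions RealInnerProductSpace Laplacian ContDiff

namespace NeumannGreen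

/-- Euclidean space `ℝⁿ`. -/
abbrev Space (n : ℕ) : Type := EuclideanSpace ℝ (Fin n)

/-- The open unit ball `B` of `ℝⁿ`, as an open set. -/
def unitBall (n : ℕ) : TopologicalSpace.Opens (Space n) :=
  ⟨ball 0 1, isOpen_ball⟩

/-- The surface area `ω_n` of the unit sphere of `ℝⁿ`. -/
noncomputable def surfaceArea (n : ℕ) : ℝ :=
  (volume : Measure (Space n)).toSphere.real Set.univ

/-- The fundamental solution `Φ` of the Laplacian on `ℝⁿ`, `n ≥ 1`. -/
noncomputable def fundamentalSolution (n : ℕ) (x : Space n) : ℝ :=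
  if n = 1 then 1 / surfaceArea 1 * ‖x‖
  else if n = 2 then 1 / surfaceArea 2 * Real.log ‖x‖
  else -(1 / (((n : ℝ) - 2) * surfaceArea n * ‖x‖ ^ (n - 2)))

/-- The integrand `(x · z/|z| - 1/s) / |s x - z/|z||ⁿ + 1/s`. -/
noncomputable def greenIntegrand (n : ℕ) (z x : Space n) (s : ℝ) : ℝ :=
  (⟪x, ‖z‖⁻¹ • z⟫ - 1 / s) / ‖s • x - ‖z‖⁻¹ • z‖ ^ n + 1 / s

/-- The function `G_z`. -/
noncomputable def green (n : ℕ) (z x : Space n) : ℝ :=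
  fundamentalSolution n (x - z)
    + 1 / surfaceArea n * (∫ s in (0 : ℝ)..‖z‖, greenIntegrand n z x s)
    - 1 / (2 * surfaceArea n) * ‖x‖ ^ 2

/-- `u` solves `Δu = δ_z - n/ω_n` in `B` in the sense of distributions: `u` is locally integrable
in `B`, and the identity holds when tested with every smooth function compactly supported in `B`. -/
def SolvesPoisson (n : ℕ) (z : Space n) (u : Space n → ℝ) : Prop :=
  LocallyIntegrableOn u (ball 0 1) volume ∧
    ∀ φ : 𝓓(unitBall n, ℝ),
      ∫ x in ball (0 : Space n) 1, u x * (Δ (φ : Space n → ℝ)) x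
        = φ z - n / surfaceArea n * ∫ x in ball (0 : Space n) 1, φ x

/-- `∇u · ν = 0` on `∂B`, where `ν = x` at `x ∈ ∂B`: at every boundary point `u` has a gradient
relative to the closed ball, and that gradient is orthogonal to the outward normal. -/
def HasZeroNeumannData (n : ℕ) (u : Space n → ℝ) : Prop :=
  ∀ x ∈ sphere (0 : Space n) 1,
    ∃ g : Space n, HasGradientWithinAt u g (closedBall 0 1) x ∧ ⟪g, x⟫ = 0

/-- `u` solves the Neumann--Poisson problem on the unit ball with source `δ_z - n/ω_n`. -/
def IsNeumannGreen (n : ℕ) (z : Space n) (u : Space n → ℝ) : Prop :=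
  SolvesPoisson n z u ∧ HasZeroNeumannData n u

end NeumannGreen

/-!
Existence rests on the distributional identity `ΔΦ(· - z) = δ_z`. Writing `Φ(x) = L(|x|²)`, the
smooth functions `L(|x|² + c⁻²)` decrease to `Φ`, and their Laplacians are rescalings `cⁿ η(c x)`
of one kernel `η` of integral one; Green's identity and dominated convergence give the identity
(`integral_fundamentalSolution_mul_laplacian`). Differentiating
`∫ Φ(x - t e) Δφ(x) dx = φ(t e) = 0` in `t > 1` shows that the dipole field `∂_e Φ(· - t e)` is
weakly harmonic in the ball. For fixed `s` the integrand of the correction term is such a field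
with `t = 1 / s`, up to a factor and an additive constant, so the correction is weakly harmonic by
Fubini (`integral_correction_mul_laplacian`), while `|x|² / (2 ω_n)` accounts for the constant
source. For the boundary condition write the integrand as `(g(s x) + 1) / s` with
`g(y) = (y · e - 1) / |y - e|ⁿ`. The gradient of the integrand in `x` is `∇g(s x)`, bounded
uniformly in `s`, and the radial derivative of the correction is `∫ d/ds g(s x) ds = g(|z| x) + 1`.
On the unit sphere `||z| x - e| = |x - z|`, so this cancels the normal derivatives of the other two
terms (`hasZeroNeumannData_green`).

For uniqueness, the difference `w` of a solution and `G_z` is weakly harmonic. Averages against a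
rescaled radial bump do not depend on the radius, because the derivative of the bump in the radius
is a multiple of the Laplacian of a test function (`WeaklyHarmonicOn.bumpAverage_eq`). This gives
Weyl's lemma (`WeaklyHarmonicOn.exists_continuousOn`) and the maximum principle for continuous
weakly harmonic functions, without passing through classical differentiability. Replacing `w` in
the ball by its continuous representative keeps the derivatives at boundary points
(`hasFDerivWithinAt_of_ae_eq`). If the maximum over the closed ball is attained inside, the strong
maximum principle makes the function constant; otherwise Hopf's lemma, with the fundamental
solution as barrier on an annulus, contradicts the boundary condition
(`WeaklyHarmonicOn.radial_deriv_ne_zero`).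
-/

namespace NeumannGreen

open Filter Topology

variable {n : ℕ}

/-! ### The Laplacian of radial functions and Green's identity -/

theorem hasFDerivAt_comp_norm_sq {f : ℝ → ℝ} {f' : ℝ} {x : Space n}
    (hf : HasDerivAt f f' (‖x‖ ^ 2)) :
    HasFDerivAt (fun y : Space n => f (‖y‖ ^ 2)) ((2 * f') • innerSL ℝ x) x := by
  have h1 : HasFDerivAt (fun y : Space n => ‖y‖ ^ 2) (2 • (innerSL ℝ x)) x :=
    (hasStrictFDerivAt_norm_sq x).hasFDerivAt
  have h2 := hf.comp_hasFDerivAt x h1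
  have h3 : (2 * f') • innerSL ℝ x = f' • 2 • innerSL ℝ x := by
    ext v
    simp
    ring
  rw [h3]
  exact h2

/-- The Laplacian of `y ↦ f(|y|²)` is `2 n f'(|y|²) + 4 |y|² f''(|y|²)`. -/
theorem laplacian_comp_norm_sq {f f' : ℝ → ℝ} {f'' : ℝ} {x : Space n}
    (hf : ∀ᶠ t in 𝓝 (‖x‖ ^ 2), HasDerivAt f (f' t) t) (hf' : HasDerivAt f' f'' (‖x‖ ^ 2)) :
    (Δ (fun y : Space n => f (‖y‖ ^ 2))) x = 2 * n * f' (‖x‖ ^ 2) + 4 * ‖x‖ ^ 2 * f'' := by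
  have hcont : Tendsto (fun y : Space n => ‖y‖ ^ 2) (𝓝 x) (𝓝 (‖x‖ ^ 2)) :=
    (continuous_norm.pow 2).continuousAt
  have h1 : fderiv ℝ (fun y : Space n => f (‖y‖ ^ 2)) =ᶠ[𝓝 x]
      fun y => (2 * f' (‖y‖ ^ 2)) • innerSL ℝ y := by
    filter_upwards [hcont.eventually hf] with y hy
    exact (hasFDerivAt_comp_norm_sq hy).fderiv
  let L : Space n →L[ℝ] Space n →L[ℝ] ℝ := innerSL ℝ
  have h2 : HasFDerivAt (fun y : Space n => (2 * f' (‖y‖ ^ 2)) • innerSL ℝ y)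
      ((2 * f' (‖x‖ ^ 2)) • L +
        ((2 : ℝ) • ((2 * f'') • innerSL ℝ x)).smulRight (innerSL ℝ x)) x :=
    ((hasFDerivAt_comp_norm_sq hf').const_mul 2).smul L.hasFDerivAt
  rw [InnerProductSpace.laplacian_eq_iteratedFDeriv_orthonormalBasis _
    (EuclideanSpace.basisFun (Fin n) ℝ)]
  have hL : ∀ v w, L v w = ⟪v, w⟫ := fun v w => rfl
  simp only [iteratedFDeriv_two_apply, h1.fderiv_eq, h2.fderiv]
  simp [hL, Finset.sum_add_distrib, EuclideanSpace.norm_sq_eq, Finset.mul_sum,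
    EuclideanSpace.inner_single_right]
  rw [Finset.sum_mul]
  congr 1
  · ring
  · refine Finset.sum_congr rfl fun i _ => by ring

theorem laplacian_comp_sub (φ : Space n → ℝ) (a x : Space n) :
    (Δ (fun y => φ (y - a))) x = (Δ φ) (x - a) := by
  simp only [InnerProductSpace.laplacian_eq_iteratedFDeriv_orthonormalBasis _
    (EuclideanSpace.basisFun (Fin n) ℝ), iteratedFDeriv_comp_sub]

theorem laplacian_eq_zero_of_notMem_tsupport {φ : Space n → ℝ} {x : Space n}
    (hx : x ∉ tsupport φ) : (Δ φ) x = 0 := by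
  have h : φ =ᶠ[𝓝 x] fun _ => 0 := notMem_tsupport_iff_eventuallyEq.1 hx
  rw [(InnerProductSpace.laplacian_congr_nhds h).self_of_nhds]
  simp

theorem tsupport_laplacian_subset (φ : Space n → ℝ) : tsupport (Δ φ) ⊆ tsupport φ := by
  refine closure_minimal (fun x hx => ?_) (isClosed_tsupport φ)
  by_contra h
  exact hx (laplacian_eq_zero_of_notMem_tsupport h)

theorem continuous_laplacian {φ : Space n → ℝ} (hφ : ContDiff ℝ 2 φ) : Continuous (Δ φ) := by
  rw [InnerProductSpace.laplacian_eq_iteratedFDeriv_orthonormalBasis _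
    (EuclideanSpace.basisFun (Fin n) ℝ)]
  have := hφ.continuous_iteratedFDeriv (m := 2) le_rfl
  fun_prop

theorem hasCompactSupport_laplacian {φ : Space n → ℝ} (hφ : HasCompactSupport φ) :
    HasCompactSupport (Δ φ) :=
  hφ.of_isClosed_subset (isClosed_tsupport _) (tsupport_laplacian_subset φ)

/-- Green's second identity without boundary terms. -/
theorem integral_mul_laplacian_eq {f φ : Space n → ℝ} (hf : ContDiff ℝ 2 f)
    (hφ : ContDiff ℝ 2 φ) (hc : HasCompactSupport φ) :
    ∫ x, f x * (Δ φ) x = ∫ x, (Δ f) x * φ x := by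
  have key : ∀ v : Space n,
      ∫ x, f x * fderiv ℝ (fun y => fderiv ℝ φ y v) x v
        = ∫ x, fderiv ℝ (fun y => fderiv ℝ f y v) x v * φ x := by
    intro v
    have hf1 : ContDiff ℝ 1 (fun y => fderiv ℝ f y v) :=
      (hf.fderiv_right (m := 1) (by norm_num)).clm_apply contDiff_const
    have hφ1 : ContDiff ℝ 1 (fun y => fderiv ℝ φ y v) :=
      (hφ.fderiv_right (m := 1) (by norm_num)).clm_apply contDiff_const
    have cφ1 : HasCompactSupport (fun y => fderiv ℝ φ y v) := hc.fderiv_apply ℝ v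
    have hf2 : Continuous (fun y => fderiv ℝ (fun y => fderiv ℝ f y v) y v) :=
      (hf1.continuous_fderiv one_ne_zero).clm_apply continuous_const
    have hφ2 : Continuous (fun y => fderiv ℝ (fun y => fderiv ℝ φ y v) y v) :=
      (hφ1.continuous_fderiv one_ne_zero).clm_apply continuous_const
    have cφ2 : HasCompactSupport (fun y => fderiv ℝ (fun y => fderiv ℝ φ y v) y v) :=
      cφ1.fderiv_apply ℝ v
    rw [integral_mul_fderiv_eq_neg_fderiv_mul_of_integrable
        ((hf1.continuous.mul hφ1.continuous).integrable_of_hasCompactSupport cφ1.mul_left)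
        ((hf.continuous.mul hφ2).integrable_of_hasCompactSupport cφ2.mul_left)
        ((hf.continuous.mul hφ1.continuous).integrable_of_hasCompactSupport cφ1.mul_left)
        (fun x _ => hf.differentiable two_ne_zero x)
        (fun x _ => hφ1.differentiable one_ne_zero x),
      integral_mul_fderiv_eq_neg_fderiv_mul_of_integrable
        ((hf2.mul hφ.continuous).integrable_of_hasCompactSupport hc.mul_left)
        ((hf1.continuous.mul hφ1.continuous).integrable_of_hasCompactSupport cφ1.mul_left)
        ((hf1.continuous.mul hφ.continuous).integrable_of_hasCompactSupport hc.mul_left)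
        (fun x _ => hf1.differentiable one_ne_zero x)
        (fun x _ => hφ.differentiable two_ne_zero x), neg_neg]
  have lap : ∀ {g : Space n → ℝ}, ContDiff ℝ 2 g → ∀ x, (Δ g) x = ∑ i,
      fderiv ℝ (fun y => fderiv ℝ g y (EuclideanSpace.basisFun (Fin n) ℝ i)) x
        (EuclideanSpace.basisFun (Fin n) ℝ i) := by
    intro g hg x
    rw [InnerProductSpace.laplacian_eq_iteratedFDeriv_orthonormalBasis _
      (EuclideanSpace.basisFun (Fin n) ℝ)]
    refine Finset.sum_congr rfl fun i _ => ?_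
    rw [iteratedFDeriv_two_apply, fderiv_clm_apply
      ((hg.fderiv_right (m := 1) (by norm_num)).differentiable one_ne_zero x)
      (differentiableAt_const _)]
    simp
  have cont : ∀ {g : Space n → ℝ}, ContDiff ℝ 2 g → ∀ v,
      Continuous (fun x => fderiv ℝ (fun y => fderiv ℝ g y v) x v) := fun hg v =>
    ((((hg.fderiv_right (m := 1) (by norm_num)).clm_apply
      contDiff_const).continuous_fderiv one_ne_zero).clm_apply continuous_const)
  simp_rw [lap hφ, lap hf, Finset.mul_sum, Finset.sum_mul]
  rw [integral_finsetSum, integral_finsetSum]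
  · exact Finset.sum_congr rfl fun i _ => key _
  · intro i _
    exact ((cont hf _).mul hφ.continuous).integrable_of_hasCompactSupport hc.mul_left
  · intro i _
    exact (hf.continuous.mul (cont hφ _)).integrable_of_hasCompactSupport
      ((hc.fderiv_apply ℝ _).fderiv_apply ℝ _).mul_left

/-! ### The fundamental solution and its regularization -/

theorem surfaceArea_eq (n : ℕ) :
    surfaceArea n = n * (volume : Measure (Space n)).real (ball 0 1) := by
  rw [surfaceArea, Measure.toSphere_real_apply_univ, finrank_euclideanSpace_fin]

theorem surfaceArea_pos (hn : 1 ≤ n) : 0 < surfaceArea n := by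
  rw [surfaceArea_eq]
  have h1 : 0 < (volume : Measure (Space n)).real (ball 0 1) :=
    ENNReal.toReal_pos (measure_ball_pos _ _ one_pos).ne' measure_ball_lt_top.ne
  have : (0 : ℝ) < n := by exact_mod_cast hn
  positivity

/-- The function `L` with `Φ(x) = L(|x|²)`. -/
noncomputable def fundamentalProfile (n : ℕ) (t : ℝ) : ℝ :=
  if n = 1 then 1 / surfaceArea 1 * √t
  else if n = 2 then 1 / surfaceArea 2 * (Real.log t / 2)
  else -(1 / (((n : ℝ) - 2) * surfaceArea n)) * t ^ (-((n : ℝ) - 2) / 2)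

theorem fundamentalSolution_eq_profile (hn : 1 ≤ n) (x : Space n) :
    fundamentalSolution n x = fundamentalProfile n (‖x‖ ^ 2) := by
  unfold fundamentalSolution fundamentalProfile
  split_ifs with h1 h2
  · rw [Real.sqrt_sq (norm_nonneg x)]
  · rw [Real.log_pow]
    push_cast
    ring
  · have h3 : (‖x‖ ^ 2 : ℝ) ^ (-((n : ℝ) - 2) / 2) = (‖x‖ ^ (n - 2))⁻¹ := by
      rw [← Real.rpow_natCast ‖x‖ 2, ← Real.rpow_mul (norm_nonneg x), ← Real.rpow_natCast,
        ← Real.rpow_neg (norm_nonneg x), Nat.cast_sub (by omega)]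
      congr 1
      push_cast
      ring
    rw [h3]
    simp only [one_div, mul_inv]
    ring

/-- The three cases of `Φ` share the formula `L'(t) = t ^ (-n / 2) / (2 ω_n)`. -/
theorem hasDerivAt_fundamentalProfile (hn : 1 ≤ n) {t : ℝ} (ht : 0 < t) :
    HasDerivAt (fundamentalProfile n) (1 / (2 * surfaceArea n) * t ^ (-(n : ℝ) / 2)) t := by
  have hω := (surfaceArea_pos hn).ne'
  unfold fundamentalProfile
  split_ifs with h1 h2
  · subst h1
    convert! (Real.hasDerivAt_sqrt ht.ne').const_mul (1 / surfaceArea 1) using 1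
    have : t ^ (-((1 : ℕ) : ℝ) / 2) = (√t)⁻¹ := by
      rw [Real.sqrt_eq_rpow, ← Real.rpow_neg ht.le]
      norm_num
    rw [this]
    simp only [one_div, mul_inv]
    ring
  · subst h2
    convert! ((Real.hasDerivAt_log ht.ne').div_const 2).const_mul (1 / surfaceArea 2) using 1
    have : t ^ (-((2 : ℕ) : ℝ) / 2) = t⁻¹ := by
      rw [← Real.rpow_neg_one]
      norm_num
    rw [this]
    simp only [one_div, mul_inv]
    ring
  · have h3 : ((n : ℝ) - 2) ≠ 0 := by
      rw [sub_ne_zero]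
      exact_mod_cast h2
    convert! (Real.hasDerivAt_rpow_const (p := -((n : ℝ) - 2) / 2) (Or.inl ht.ne')).const_mul
      (-(1 / (((n : ℝ) - 2) * surfaceArea n))) using 1
    rw [show -((n : ℝ) - 2) / 2 - 1 = -(n : ℝ) / 2 by ring]
    field_simp

theorem contDiffAt_fundamentalProfile {t : ℝ} (ht : 0 < t) :
    ContDiffAt ℝ 2 (fundamentalProfile n) t := by
  unfold fundamentalProfile
  split_ifs with h1 h2
  · exact contDiffAt_const.mul (Real.contDiffAt_sqrt ht.ne')
  · exact contDiffAt_const.mul ((Real.contDiffAt_log.2 ht.ne').div_const 2)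
  · exact contDiffAt_const.mul (Real.contDiffAt_rpow_const_of_ne ht.ne')

theorem fundamentalProfile_mono (hn : 1 ≤ n) {s t : ℝ} (hs : 0 < s) (hst : s ≤ t) :
    fundamentalProfile n s ≤ fundamentalProfile n t := by
  have hω := surfaceArea_pos hn
  have h : MonotoneOn (fundamentalProfile n) (Set.Ioi 0) := by
    refine monotoneOn_of_deriv_nonneg (convex_Ioi 0)
      (fun t ht => (hasDerivAt_fundamentalProfile hn ht).continuousAt.continuousWithinAt)
      (fun t ht => ?_) (fun t ht => ?_)
    · rw [interior_Ioi] at ht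
      exact (hasDerivAt_fundamentalProfile hn ht).differentiableAt.differentiableWithinAt
    · rw [interior_Ioi] at ht
      rw [(hasDerivAt_fundamentalProfile hn ht).deriv]
      have := Real.rpow_nonneg (le_of_lt ht) (-(n : ℝ) / 2)
      positivity
  exact h hs (hs.trans_le hst) hst

/-- The smooth function `L(|x|² + c⁻²)`, which tends to `Φ` as `c → ∞`. -/
noncomputable def regularizedSolution (n : ℕ) (c : ℝ) (x : Space n) : ℝ :=
  fundamentalProfile n (‖x‖ ^ 2 + (c ^ 2)⁻¹)

/-- The kernel `η` with `∫ η = 1` for which the Laplacian of the regularized fundamental solution is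
`cⁿ η(c x)`. -/
noncomputable def peakKernel (n : ℕ) (x : Space n) : ℝ :=
  n / surfaceArea n * (1 + ‖x‖ ^ 2) ^ (-(n : ℝ) / 2 - 1)

theorem contDiff_regularizedSolution {c : ℝ} (hc : 0 < c) :
    ContDiff ℝ 2 (regularizedSolution n c) := by
  rw [contDiff_iff_contDiffAt]
  intro x
  have h : 0 < ‖x‖ ^ 2 + (c ^ 2)⁻¹ := by positivity
  exact (contDiffAt_fundamentalProfile h).comp x
    ((contDiff_norm_sq ℝ).add contDiff_const).contDiffAt

theorem laplacian_regularizedSolution (hn : 1 ≤ n) {c : ℝ} (hc : 0 < c) (x : Space n) :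
    (Δ (regularizedSolution n c)) x = c ^ n * peakKernel n (c • x) := by
  have hω := (surfaceArea_pos hn).ne'
  have hpos : ∀ x : Space n, 0 < ‖x‖ ^ 2 + (c ^ 2)⁻¹ := fun x => by positivity
  have h := laplacian_comp_norm_sq (x := x) (f := fun t => fundamentalProfile n (t + (c ^ 2)⁻¹))
    (f' := fun t => 1 / (2 * surfaceArea n) * (t + (c ^ 2)⁻¹) ^ (-(n : ℝ) / 2))
    (f'' := 1 / (2 * surfaceArea n) *
      ((-(n : ℝ) / 2) * (‖x‖ ^ 2 + (c ^ 2)⁻¹) ^ (-(n : ℝ) / 2 - 1))) ?_ ?_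
  · refine Eq.trans h ?_
    have e1 : (‖x‖ ^ 2 + (c ^ 2)⁻¹) ^ (-(n : ℝ) / 2)
        = (‖x‖ ^ 2 + (c ^ 2)⁻¹) * (‖x‖ ^ 2 + (c ^ 2)⁻¹) ^ (-(n : ℝ) / 2 - 1) := by
      rw [Real.rpow_sub_one (hpos x).ne']
      field_simp
    have e2 : (1 + ‖c • x‖ ^ 2) ^ (-(n : ℝ) / 2 - 1)
        = (c ^ n)⁻¹ * (c ^ 2)⁻¹ * (‖x‖ ^ 2 + (c ^ 2)⁻¹) ^ (-(n : ℝ) / 2 - 1) := by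
      have : 1 + ‖c • x‖ ^ 2 = c ^ 2 * (‖x‖ ^ 2 + (c ^ 2)⁻¹) := by
        rw [norm_smul, Real.norm_of_nonneg hc.le]
        field_simp
        ring
      rw [this, Real.mul_rpow (by positivity) (hpos x).le, ← Real.rpow_natCast c 2,
        ← Real.rpow_mul hc.le, ← Real.rpow_natCast c n, ← Real.rpow_neg hc.le,
        ← Real.rpow_neg hc.le, ← Real.rpow_add hc]
      congr 2
      push_cast
      ring
    rw [peakKernel, e2, e1]
    field_simp
    ring
  · have ht : Tendsto (fun t : ℝ => t + (c ^ 2)⁻¹) (𝓝 (‖x‖ ^ 2)) (𝓝 (‖x‖ ^ 2 + (c ^ 2)⁻¹)) :=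
      (continuous_id.add continuous_const).continuousAt
    filter_upwards [ht.eventually (lt_mem_nhds (hpos x))] with t h
    exact (hasDerivAt_fundamentalProfile hn h).comp_add_const t _
  · have := (Real.hasDerivAt_rpow_const (p := -(n : ℝ) / 2)
      (Or.inl (hpos x).ne')).comp_add_const (‖x‖ ^ 2) ((c ^ 2)⁻¹)
    exact this.const_mul _

theorem peakKernel_nonneg (hn : 1 ≤ n) (x : Space n) : 0 ≤ peakKernel n x := by
  have := surfaceArea_pos hn
  unfold peakKernel
  positivity

/-- In polar coordinates the integrand has the primitive `rⁿ (1 + r²) ^ (-n / 2)`, which increases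
from `0` to `1`. -/
theorem integral_peakKernel (hn : 1 ≤ n) : ∫ x, peakKernel n x = 1 := by
  have hω := (surfaceArea_pos hn).ne'
  have : Nonempty (Fin n) := ⟨⟨0, hn⟩⟩
  have h := integral_fun_norm_addHaar (volume : Measure (Space n))
    (fun r => n / surfaceArea n * (1 + r ^ 2) ^ (-(n : ℝ) / 2 - 1))
  refine Eq.trans h ?_
  rw [finrank_euclideanSpace_fin]
  have hint : ∫ r in Set.Ioi (0 : ℝ), n * r ^ (n - 1) * (1 + r ^ 2) ^ (-(n : ℝ) / 2 - 1)
      = 1 - 0 ^ n * (1 + (0 : ℝ) ^ 2) ^ (-(n : ℝ) / 2) := by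
    refine integral_Ioi_of_hasDerivAt_of_nonneg'
      (g := fun r : ℝ => r ^ n * (1 + r ^ 2) ^ (-(n : ℝ) / 2)) (fun r _ => ?_) (fun r hr => ?_) ?_
    · have hp : 0 < 1 + r ^ 2 := by positivity
      have h1 : HasDerivAt (fun r : ℝ => 1 + r ^ 2) (2 * r) r := by
        simpa using (hasDerivAt_pow 2 r).const_add 1
      have h2 := (hasDerivAt_pow n r).mul (h1.rpow_const (p := -(n : ℝ) / 2) (Or.inl hp.ne'))
      convert! h2 using 1
      have e1 : (1 + r ^ 2) ^ (-(n : ℝ) / 2)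
          = (1 + r ^ 2) * (1 + r ^ 2) ^ (-(n : ℝ) / 2 - 1) := by
        rw [Real.rpow_sub_one hp.ne']
        field_simp
      have e2 : r ^ n = r * r ^ (n - 1) := by
        rw [← pow_succ', Nat.sub_add_cancel hn]
      rw [e1, e2]
      ring
    · have : (0 : ℝ) < r := hr
      positivity
    · have h1 : Tendsto (fun r : ℝ => (1 - (1 + r ^ 2)⁻¹) ^ ((n : ℝ) / 2)) atTop (𝓝 1) := by
        have h2 : Tendsto (fun r : ℝ => 1 - (1 + r ^ 2)⁻¹) atTop (𝓝 (1 - 0)) :=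
          tendsto_const_nhds.sub (tendsto_inv_atTop_zero.comp
            (tendsto_atTop_add_const_left _ _ (tendsto_pow_atTop two_ne_zero)))
        have h3 := h2.rpow_const (p := (n : ℝ) / 2) (Or.inl (by norm_num))
        simpa using h3
      refine h1.congr' ?_
      filter_upwards [eventually_gt_atTop 0] with r hr
      have hp : 0 < 1 + r ^ 2 := by positivity
      have : 1 - (1 + r ^ 2)⁻¹ = r ^ 2 * (1 + r ^ 2)⁻¹ := by
        field_simp
        ring
      rw [this, Real.mul_rpow (by positivity) (by positivity), Real.inv_rpow hp.le,
        ← Real.rpow_neg hp.le, ← Real.rpow_natCast r 2, ← Real.rpow_mul hr.le,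
        ← Real.rpow_natCast r n]
      congr 2 <;> push_cast <;> ring
  have e : ∀ r : ℝ, r ^ (n - 1) • (n / surfaceArea n * (1 + r ^ 2) ^ (-(n : ℝ) / 2 - 1))
      = (surfaceArea n)⁻¹ * (n * r ^ (n - 1) * (1 + r ^ 2) ^ (-(n : ℝ) / 2 - 1)) := by
    intro r
    rw [smul_eq_mul]
    ring
  simp only [e, integral_const_mul, hint]
  rw [nsmul_eq_mul, smul_eq_mul, ← mul_assoc, ← surfaceArea_eq]
  rw [zero_pow (by omega : n ≠ 0), mul_inv_cancel_left₀ hω]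
  norm_num

theorem tendsto_norm_pow_mul_peakKernel (hn : 1 ≤ n) :
    Tendsto (fun x : Space n => ‖x‖ ^ n * peakKernel n x) (Bornology.cobounded (Space n))
      (𝓝 0) := by
  have hω := surfaceArea_pos hn
  have h1 : Tendsto (fun x : Space n => n / surfaceArea n * (1 + ‖x‖ ^ 2)⁻¹)
      (Bornology.cobounded (Space n)) (𝓝 (n / surfaceArea n * 0)) :=
    (tendsto_inv_atTop_zero.comp (tendsto_atTop_add_const_left _ _
      ((tendsto_pow_atTop two_ne_zero).comp tendsto_norm_cobounded_atTop))).const_mul _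
  rw [mul_zero] at h1
  refine squeeze_zero (fun x => ?_) (fun x => ?_) h1
  · have := peakKernel_nonneg hn x
    positivity
  · have hp : 0 < 1 + ‖x‖ ^ 2 := by positivity
    have h2 : ‖x‖ ^ n ≤ (1 + ‖x‖ ^ 2) ^ ((n : ℝ) / 2) := by
      calc ‖x‖ ^ n = (‖x‖ ^ 2) ^ ((n : ℝ) / 2) := by
            rw [← Real.rpow_natCast ‖x‖ 2, ← Real.rpow_mul (norm_nonneg x),
              ← Real.rpow_natCast ‖x‖ n]
            congr 1
            push_cast
            ring
        _ ≤ _ := Real.rpow_le_rpow (by positivity) (by linarith) (by positivity)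
    have h3 : (1 + ‖x‖ ^ 2) ^ ((n : ℝ) / 2) * (1 + ‖x‖ ^ 2) ^ (-(n : ℝ) / 2 - 1)
        = (1 + ‖x‖ ^ 2)⁻¹ := by
      rw [← Real.rpow_add hp, ← Real.rpow_neg_one]
      congr 1
      ring
    rw [peakKernel, ← h3]
    have h4 : 0 ≤ (1 + ‖x‖ ^ 2) ^ (-(n : ℝ) / 2 - 1) := by positivity
    have h5 : 0 ≤ n / surfaceArea n := by positivity
    nlinarith [mul_le_mul_of_nonneg_right h2 (mul_nonneg h5 h4)]

theorem continuousAt_fundamentalSolution (hn : 1 ≤ n) {x : Space n} (hx : x ≠ 0) :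
    ContinuousAt (fundamentalSolution n) x := by
  have h0 : 0 < ‖x‖ ^ 2 := by positivity
  simp only [funext (fundamentalSolution_eq_profile hn)]
  exact ContinuousAt.comp (f := fun x : Space n => ‖x‖ ^ 2)
    (hasDerivAt_fundamentalProfile hn h0).continuousAt (by fun_prop)

theorem integrableOn_fundamentalSolution (hn : 1 ≤ n) (r : ℝ) :
    IntegrableOn (fundamentalSolution n) (ball 0 r) := by
  have : Nonempty (Fin n) := ⟨⟨0, hn⟩⟩
  have h := integrableOn_fun_norm_addHaar (volume : Measure (Space n)) (r := r)
    (f := fun r => fundamentalProfile n (r ^ 2))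
  have e : fundamentalSolution n = fun x => fundamentalProfile n (‖x‖ ^ 2) :=
    funext (fundamentalSolution_eq_profile hn)
  rw [e]
  refine h.2 ?_
  -- In polar coordinates the density `rⁿ⁻¹ L(r²)` agrees with a continuous function
  have hcont : ∃ g : ℝ → ℝ, Continuous g ∧
      ∀ y > 0, g y = y ^ (n - 1) • fundamentalProfile n (y ^ 2) := by
    unfold fundamentalProfile
    split_ifs with h1 h2
    · exact ⟨fun y => y ^ (n - 1) • (1 / surfaceArea 1 * √(y ^ 2)), by fun_prop, fun _ _ => rfl⟩
    · refine ⟨fun y => 1 / surfaceArea 2 * (y * Real.log y),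
        continuous_const.mul Real.continuous_mul_log, fun y hy => ?_⟩
      rw [Real.log_pow, h2, smul_eq_mul]
      push_cast
      ring
    · refine ⟨fun y => -(1 / (((n : ℝ) - 2) * surfaceArea n)) * y, by fun_prop, fun y hy => ?_⟩
      rw [smul_eq_mul, ← Real.rpow_natCast y 2, ← Real.rpow_mul hy.le, ← Real.rpow_natCast,
        Nat.cast_sub hn, mul_left_comm, ← Real.rpow_add hy]
      congr 1
      push_cast
      rw [show (n : ℝ) - 1 + 2 * (-(n - 2) / 2) = 1 by ring, Real.rpow_one]
  obtain ⟨g, hg, hge⟩ := hcont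
  rw [finrank_euclideanSpace_fin]
  refine (hg.integrableOn_Icc (a := 0) (b := r)).mono_set Set.Ioo_subset_Icc_self |>.congr_fun
    (fun y hy => hge y hy.1) measurableSet_Ioo

theorem locallyIntegrable_fundamentalSolution (hn : 1 ≤ n) :
    LocallyIntegrable (fundamentalSolution n) := by
  intro x
  exact ⟨ball 0 (‖x‖ + 1), isOpen_ball.mem_nhds (by simp),
    integrableOn_fundamentalSolution hn _⟩

/-! ### The fundamental solution as a distribution -/

theorem nullSingletonClass_volume (hn : 1 ≤ n) :
    NullSingletonClass (volume : Measure (Space n)) := by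
  have : Nonempty (Fin n) := ⟨⟨0, hn⟩⟩
  infer_instance

theorem tendsto_regularizedSolution (hn : 1 ≤ n) {x : Space n} (hx : x ≠ 0) :
    Tendsto (fun c => regularizedSolution n c x) atTop (𝓝 (fundamentalSolution n x)) := by
  have h0 : 0 < ‖x‖ ^ 2 := by positivity
  rw [fundamentalSolution_eq_profile hn]
  refine (hasDerivAt_fundamentalProfile hn h0).continuousAt.tendsto.comp ?_
  have h1 : Tendsto (fun c : ℝ => ‖x‖ ^ 2 + (c ^ 2)⁻¹) atTop (𝓝 (‖x‖ ^ 2 + 0)) :=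
    tendsto_const_nhds.add (tendsto_inv_atTop_zero.comp (tendsto_pow_atTop two_ne_zero))
  simpa using h1

/-- Since the profile is increasing, the regularizations lie between `Φ` and the first of them. -/
theorem abs_regularizedSolution_le (hn : 1 ≤ n) {x : Space n} (hx : x ≠ 0) {c : ℝ} (hc : 1 ≤ c) :
    |regularizedSolution n c x| ≤ |fundamentalSolution n x| + |regularizedSolution n 1 x| := by
  have h0 : 0 < ‖x‖ ^ 2 := by positivity
  have hc0 : 0 < c := by linarith
  have h1 : fundamentalSolution n x ≤ regularizedSolution n c x := by
    rw [fundamentalSolution_eq_profile hn]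
    exact fundamentalProfile_mono hn h0 (by simp; positivity)
  have h2 : regularizedSolution n c x ≤ regularizedSolution n 1 x := by
    refine fundamentalProfile_mono hn (by positivity) ?_
    have : (c ^ 2)⁻¹ ≤ 1 := inv_le_one_of_one_le₀ (one_le_pow₀ hc)
    simpa using this
  rw [abs_le]
  constructor
  · have := neg_abs_le (fundamentalSolution n x)
    have := abs_nonneg (regularizedSolution n 1 x)
    linarith
  · have := le_abs_self (regularizedSolution n 1 x)
    have := abs_nonneg (fundamentalSolution n x)
    linarith

theorem integral_fundamentalSolution_mul_laplacian_zero (hn : 1 ≤ n) {φ : Space n → ℝ}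
    (hφ : ContDiff ℝ 2 φ) (hc : HasCompactSupport φ) :
    ∫ x, fundamentalSolution n x * (Δ φ) x = φ 0 := by
  have := nullSingletonClass_volume hn
  have hΔ := continuous_laplacian hφ
  have hΔc := hasCompactSupport_laplacian hc
  have lim1 : Tendsto (fun c => ∫ x, regularizedSolution n c x * (Δ φ) x) atTop
      (𝓝 (∫ x, fundamentalSolution n x * (Δ φ) x)) := by
    refine tendsto_integral_filter_of_dominated_convergence
      (fun x => (|fundamentalSolution n x| + |regularizedSolution n 1 x|) * |(Δ φ) x|) ?_ ?_ ?_ ?_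
    · filter_upwards [eventually_gt_atTop 0] with c hc
      exact ((contDiff_regularizedSolution hc).continuous.mul hΔ).aestronglyMeasurable
    · filter_upwards [eventually_ge_atTop 1] with c hc
      filter_upwards [compl_mem_ae_iff.2 (measure_singleton (0 : Space n))] with x hx
      rw [norm_mul, Real.norm_eq_abs, Real.norm_eq_abs]
      exact mul_le_mul_of_nonneg_right (abs_regularizedSolution_le hn hx hc) (abs_nonneg _)
    · have h1 : Integrable (fun x => fundamentalSolution n x * (Δ φ) x) :=
        (locallyIntegrable_fundamentalSolution hn).integrable_smul_right_of_hasCompactSupport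
          hΔ hΔc
      have h2 : Integrable (fun x => regularizedSolution n 1 x * (Δ φ) x) :=
        ((contDiff_regularizedSolution one_pos).continuous.mul
          hΔ).integrable_of_hasCompactSupport hΔc.mul_left
      refine (h1.norm.add h2.norm).congr (Eventually.of_forall fun x => ?_)
      simp [add_mul]
    · filter_upwards [compl_mem_ae_iff.2 (measure_singleton (0 : Space n))] with x hx
      exact (tendsto_regularizedSolution hn hx).mul_const _
  have lim2 : Tendsto (fun c => ∫ x, regularizedSolution n c x * (Δ φ) x) atTop (𝓝 (φ 0)) := by
    have h := tendsto_integral_comp_smul_smul_of_integrable (μ := (volume : Measure (Space n)))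
      (φ := peakKernel n) (peakKernel_nonneg hn) (integral_peakKernel hn)
      (by simpa using tendsto_norm_pow_mul_peakKernel hn)
      (hφ.continuous.integrable_of_hasCompactSupport hc) hφ.continuous.continuousAt
    refine h.congr' ?_
    filter_upwards [eventually_gt_atTop 0] with c hc0
    rw [integral_mul_laplacian_eq (contDiff_regularizedSolution hc0) hφ hc]
    simp [laplacian_regularizedSolution hn hc0]
  exact tendsto_nhds_unique lim1 lim2

/-- `Φ(· - z)` satisfies `ΔΦ(· - z) = δ_z` in the sense of distributions. -/
theorem integral_fundamentalSolution_mul_laplacian (hn : 1 ≤ n) {φ : Space n → ℝ}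
    (hφ : ContDiff ℝ 2 φ) (hc : HasCompactSupport φ) (z : Space n) :
    ∫ x, fundamentalSolution n (x - z) * (Δ φ) x = φ z := by
  have h := integral_fundamentalSolution_mul_laplacian_zero hn
    (φ := fun y => φ (y - (-z))) (hφ.comp (contDiff_id.sub contDiff_const))
    (hc.comp_homeomorph (Homeomorph.subRight (-z)))
  rw [zero_sub, neg_neg] at h
  rw [← integral_sub_right_eq_self _ z] at h
  simp only [laplacian_comp_sub] at h
  simpa only [sub_neg_eq_add, sub_add_cancel] using h

theorem hasFDerivAt_fundamentalSolution (hn : 1 ≤ n) {x : Space n} (hx : x ≠ 0) :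
    HasFDerivAt (fundamentalSolution n)
      ((1 / (surfaceArea n * ‖x‖ ^ n)) • innerSL ℝ x) x := by
  have h0 : 0 < ‖x‖ ^ 2 := by positivity
  have e : fundamentalSolution n = fun x => fundamentalProfile n (‖x‖ ^ 2) :=
    funext (fundamentalSolution_eq_profile hn)
  have h := hasFDerivAt_comp_norm_sq (hasDerivAt_fundamentalProfile hn h0)
  rw [e]
  convert! h using 2
  rw [← Real.rpow_natCast ‖x‖ 2, ← Real.rpow_mul (norm_nonneg x), ← Real.rpow_natCast,
    show ((2 : ℕ) : ℝ) * (-(n : ℝ) / 2) = -n by push_cast; ring, Real.rpow_neg (norm_nonneg x)]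
  simp only [one_div, mul_inv]
  ring

theorem contDiffAt_fundamentalSolution (hn : 1 ≤ n) {x : Space n} (hx : x ≠ 0) :
    ContDiffAt ℝ 2 (fundamentalSolution n) x := by
  have h0 : 0 < ‖x‖ ^ 2 := by positivity
  have e : fundamentalSolution n = fun x => fundamentalProfile n (‖x‖ ^ 2) :=
    funext (fundamentalSolution_eq_profile hn)
  rw [e]
  exact (contDiffAt_fundamentalProfile h0).comp x (contDiff_norm_sq ℝ).contDiffAt

/-! ### Averages of weakly harmonic functions -/

/-- A smooth function on `ℝ` that is positive on `(-∞, 1)` and vanishes on `[1, ∞)`. -/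
noncomputable def bumpProfile (t : ℝ) : ℝ := expNegInvGlue (1 - t)

/-- The primitive of half of `bumpProfile` that vanishes on `[1, ∞)`. -/
noncomputable def bumpPrimitive (t : ℝ) : ℝ := ∫ u in (1 : ℝ)..t, bumpProfile u / 2

theorem contDiff_bumpProfile : ContDiff ℝ ∞ bumpProfile :=
  expNegInvGlue.contDiff.comp (contDiff_const.sub contDiff_id)

theorem bumpProfile_nonneg (t : ℝ) : 0 ≤ bumpProfile t := expNegInvGlue.nonneg _

theorem bumpProfile_pos {t : ℝ} (ht : t < 1) : 0 < bumpProfile t :=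
  expNegInvGlue.pos_of_pos (by linarith)

theorem bumpProfile_eq_zero {t : ℝ} (ht : 1 ≤ t) : bumpProfile t = 0 :=
  expNegInvGlue.zero_of_nonpos (by linarith)

theorem hasDerivAt_bumpProfile (t : ℝ) : HasDerivAt bumpProfile (deriv bumpProfile t) t :=
  (contDiff_bumpProfile.differentiable (by simp) t).hasDerivAt

theorem hasDerivAt_bumpPrimitive (t : ℝ) : HasDerivAt bumpPrimitive (bumpProfile t / 2) t := by
  have hc : Continuous fun u => bumpProfile u / 2 := contDiff_bumpProfile.continuous.div_const 2
  exact intervalIntegral.integral_hasDerivAt_right (hc.intervalIntegrable _ _)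
    (hc.stronglyMeasurableAtFilter _ _) hc.continuousAt

theorem contDiff_bumpPrimitive : ContDiff ℝ ∞ bumpPrimitive := by
  rw [contDiff_infty_iff_deriv]
  refine ⟨fun t => (hasDerivAt_bumpPrimitive t).differentiableAt, ?_⟩
  rw [funext fun t => (hasDerivAt_bumpPrimitive t).deriv]
  exact contDiff_bumpProfile.div_const 2

theorem bumpPrimitive_eq_zero {t : ℝ} (ht : 1 ≤ t) : bumpPrimitive t = 0 := by
  unfold bumpPrimitive
  rw [intervalIntegral.integral_congr (g := fun _ => (0 : ℝ)) fun u hu => ?_]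
  · simp
  · rw [Set.uIcc_of_le ht] at hu
    simp [bumpProfile_eq_zero hu.1]

/-- A radial bump function supported in the closed unit ball, with integral one. -/
noncomputable def radialBump (n : ℕ) (y : Space n) : ℝ :=
  (∫ w : Space n, bumpProfile (‖w‖ ^ 2))⁻¹ * bumpProfile (‖y‖ ^ 2)

/-- The rescaling of `radialBump` to the ball of radius `1 / s`, still with integral one. -/
noncomputable def averagingKernel (n : ℕ) (s : ℝ) (y : Space n) : ℝ :=
  s ^ n * radialBump n (s • y)

theorem contDiff_radialBump : ContDiff ℝ ∞ (radialBump n) :=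
  contDiff_const.mul (contDiff_bumpProfile.comp (contDiff_norm_sq ℝ))

theorem hasCompactSupport_comp_norm_sq {f : ℝ → ℝ} (hf : ∀ t, 1 ≤ t → f t = 0) {s : ℝ}
    (hs : 0 < s) : HasCompactSupport (fun y : Space n => f (‖s • y‖ ^ 2)) := by
  refine HasCompactSupport.intro (isCompact_closedBall (0 : Space n) s⁻¹) fun y hy => hf _ ?_
  rw [mem_closedBall_zero_iff, not_le] at hy
  rw [norm_smul, Real.norm_of_nonneg hs.le]
  have : 1 < s * ‖y‖ := by
    rw [inv_lt_iff_one_lt_mul₀ hs] at hy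
    linarith
  nlinarith

theorem integral_bumpProfile_pos (n : ℕ) : 0 < ∫ w : Space n, bumpProfile (‖w‖ ^ 2) := by
  have hc : Continuous fun w : Space n => bumpProfile (‖w‖ ^ 2) :=
    contDiff_bumpProfile.continuous.comp (by fun_prop)
  have hs : HasCompactSupport fun w : Space n => bumpProfile (‖w‖ ^ 2) := by
    simpa using hasCompactSupport_comp_norm_sq (n := n) (fun t => bumpProfile_eq_zero) one_pos
  refine hc.integral_pos_of_hasCompactSupport_nonneg_nonzero hs
    (fun w => bumpProfile_nonneg _) (x := 0) ?_
  exact (bumpProfile_pos (by simp)).ne'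

theorem hasCompactSupport_radialBump (n : ℕ) : HasCompactSupport (radialBump n) := by
  have h := hasCompactSupport_comp_norm_sq (n := n) (fun t => bumpProfile_eq_zero) one_pos
  simp only [one_smul] at h
  exact h.mul_left

theorem radialBump_nonneg (y : Space n) : 0 ≤ radialBump n y :=
  mul_nonneg (inv_nonneg.2 (integral_bumpProfile_pos n).le) (bumpProfile_nonneg _)

theorem radialBump_pos {y : Space n} (hy : ‖y‖ < 1) : 0 < radialBump n y :=
  mul_pos (inv_pos.2 (integral_bumpProfile_pos n))
    (bumpProfile_pos (by nlinarith [norm_nonneg y]))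

theorem radialBump_eq_zero {y : Space n} (hy : 1 ≤ ‖y‖) : radialBump n y = 0 := by
  rw [radialBump, bumpProfile_eq_zero (by nlinarith), mul_zero]

theorem integral_radialBump (n : ℕ) : ∫ y, radialBump n y = 1 := by
  unfold radialBump
  rw [integral_const_mul, inv_mul_cancel₀ (integral_bumpProfile_pos n).ne']

theorem averagingKernel_eq_zero {s : ℝ} (hs : 0 < s) {y : Space n} (hy : s⁻¹ ≤ ‖y‖) :
    averagingKernel n s y = 0 := by
  rw [averagingKernel, radialBump_eq_zero, mul_zero]
  rw [norm_smul, Real.norm_of_nonneg hs.le]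
  rwa [inv_le_iff_one_le_mul₀ hs, mul_comm] at hy

theorem averagingKernel_pos {s : ℝ} (hs : 0 < s) {y : Space n} (hy : ‖y‖ < s⁻¹) :
    0 < averagingKernel n s y := by
  refine mul_pos (pow_pos hs n) (radialBump_pos ?_)
  rw [norm_smul, Real.norm_of_nonneg hs.le]
  have := mul_lt_mul_of_pos_left hy hs
  rwa [mul_inv_cancel₀ hs.ne'] at this

theorem averagingKernel_nonneg {s : ℝ} (hs : 0 < s) (y : Space n) :
    0 ≤ averagingKernel n s y :=
  mul_nonneg (pow_pos hs n).le (radialBump_nonneg _)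

theorem continuous_averagingKernel (n : ℕ) (s : ℝ) : Continuous (averagingKernel n s) :=
  continuous_const.mul (contDiff_radialBump.continuous.comp (by fun_prop))

theorem hasCompactSupport_averagingKernel (n : ℕ) {s : ℝ} (hs : 0 < s) :
    HasCompactSupport (averagingKernel n s) := by
  refine HasCompactSupport.intro (isCompact_closedBall (0 : Space n) s⁻¹) fun y hy => ?_
  rw [mem_closedBall_zero_iff, not_le] at hy
  exact averagingKernel_eq_zero hs hy.le

theorem integral_averagingKernel (n : ℕ) {s : ℝ} (hs : 0 < s) :
    ∫ y, averagingKernel n s y = 1 := by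
  unfold averagingKernel
  rw [integral_const_mul, Measure.integral_comp_smul, integral_radialBump,
    finrank_euclideanSpace_fin, abs_of_pos (by positivity)]
  simp [hs.ne']

/-- The average of `u` against the averaging kernel of radius `1 / s` centred at `x`. -/
noncomputable def bumpAverage (u : Space n → ℝ) (s : ℝ) (x : Space n) : ℝ :=
  ∫ y, averagingKernel n s (x - y) * u y

/-- The test function whose Laplacian is, up to a power of `s`, the derivative in `s` of the
averaging kernel. -/
noncomputable def kernelPotential (n : ℕ) (s : ℝ) (x y : Space n) : ℝ :=
  (∫ w : Space n, bumpProfile (‖w‖ ^ 2))⁻¹ * bumpPrimitive (‖s • (x - y)‖ ^ 2)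

/-- The derivative in `s` of `averagingKernel n s y`. -/
noncomputable def averagingKernelDeriv (n : ℕ) (s : ℝ) (y : Space n) : ℝ :=
  (∫ w : Space n, bumpProfile (‖w‖ ^ 2))⁻¹ * (n * s ^ (n - 1) * bumpProfile (‖s • y‖ ^ 2) +
    s ^ n * (deriv bumpProfile (‖s • y‖ ^ 2) * (2 * s * ‖y‖ ^ 2)))

theorem hasDerivAt_averagingKernel (s : ℝ) (y : Space n) :
    HasDerivAt (fun s => averagingKernel n s y) (averagingKernelDeriv n s y) s := by
  have e : ∀ s : ℝ, averagingKernel n s y = (∫ w : Space n, bumpProfile (‖w‖ ^ 2))⁻¹ *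
      (s ^ n * bumpProfile (s ^ 2 * ‖y‖ ^ 2)) := by
    intro s
    rw [averagingKernel, radialBump, norm_smul, mul_pow, Real.norm_eq_abs, sq_abs]
    ring
  have h1 : HasDerivAt (fun s : ℝ => s ^ 2 * ‖y‖ ^ 2) (2 * s * ‖y‖ ^ 2) s := by
    simpa using (hasDerivAt_pow 2 s).mul_const (‖y‖ ^ 2)
  have h2 := ((hasDerivAt_pow n s).mul
    ((hasDerivAt_bumpProfile (s ^ 2 * ‖y‖ ^ 2)).comp s h1)).const_mul
      (∫ w : Space n, bumpProfile (‖w‖ ^ 2))⁻¹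
  simp only [e]
  refine h2.congr_deriv ?_
  rw [averagingKernelDeriv, norm_smul, mul_pow, Real.norm_eq_abs, sq_abs]
  rfl

theorem contDiff_kernelPotential (s : ℝ) (x : Space n) :
    ContDiff ℝ ∞ (kernelPotential n s x) :=
  contDiff_const.mul (contDiff_bumpPrimitive.comp
    ((contDiff_norm_sq ℝ).comp (by fun_prop : ContDiff ℝ ∞ fun y => s • (x - y))))

theorem tsupport_kernelPotential_subset {s : ℝ} (hs : 0 < s) (x : Space n) :
    tsupport (kernelPotential n s x) ⊆ closedBall x s⁻¹ := by
  refine closure_minimal (fun y hy => ?_) isClosed_closedBall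
  by_contra h
  rw [mem_closedBall, not_le, dist_comm, dist_eq_norm] at h
  refine hy ?_
  have h1 : 1 < s * ‖x - y‖ := by
    rw [inv_lt_iff_one_lt_mul₀ hs] at h
    linarith
  rw [kernelPotential, bumpPrimitive_eq_zero, mul_zero]
  rw [norm_smul, Real.norm_of_nonneg hs.le]
  nlinarith

theorem hasCompactSupport_kernelPotential {s : ℝ} (hs : 0 < s) (x : Space n) :
    HasCompactSupport (kernelPotential n s x) :=
  (isCompact_closedBall x s⁻¹).of_isClosed_subset (isClosed_tsupport _)
    (tsupport_kernelPotential_subset hs x)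

theorem laplacian_kernelPotential (s : ℝ) (x y : Space n) :
    s ^ n * (Δ (kernelPotential n s x)) y = s ^ 3 * averagingKernelDeriv n s (x - y) := by
  set m := (∫ w : Space n, bumpProfile (‖w‖ ^ 2))⁻¹ with hm
  have e : kernelPotential n s x =
      fun y => m * bumpPrimitive (s ^ 2 * ‖y - x‖ ^ 2) := by
    funext y
    rw [kernelPotential, norm_smul, mul_pow, Real.norm_eq_abs, sq_abs, norm_sub_rev]
  have d1 : ∀ t : ℝ, HasDerivAt (fun t : ℝ => s ^ 2 * t) (s ^ 2) t := fun t => by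
    simpa using (hasDerivAt_id t).const_mul (s ^ 2)
  rw [e, laplacian_comp_sub (fun w => m * bumpPrimitive (s ^ 2 * ‖w‖ ^ 2)),
    laplacian_comp_norm_sq (f := fun t => m * bumpPrimitive (s ^ 2 * t))
    (f' := fun t => m * (bumpProfile (s ^ 2 * t) / 2 * s ^ 2))
    (f'' := m * (deriv bumpProfile (s ^ 2 * ‖y - x‖ ^ 2) * s ^ 2 / 2 * s ^ 2))]
  · rw [averagingKernelDeriv, norm_smul, mul_pow, Real.norm_eq_abs, sq_abs, norm_sub_rev, ← hm]
    rcases Nat.eq_zero_or_pos n with h0 | h0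
    · subst h0
      simp
      ring
    · have : s ^ n = s * s ^ (n - 1) := by rw [← pow_succ', Nat.sub_add_cancel h0]
      rw [this]
      ring
  · exact Eventually.of_forall fun t =>
      ((hasDerivAt_bumpPrimitive _).comp t (d1 t)).const_mul m
  · exact ((((hasDerivAt_bumpProfile _).comp _ (d1 _)).div_const 2).mul_const (s ^ 2)).const_mul m

theorem continuous_averagingKernelDeriv (n : ℕ) :
    Continuous fun p : ℝ × Space n => averagingKernelDeriv n p.1 p.2 := by
  have h1 := contDiff_bumpProfile.continuous
  have h2 := contDiff_bumpProfile.continuous_deriv (by simp)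
  unfold averagingKernelDeriv
  fun_prop

theorem averagingKernelDeriv_eq_zero {s : ℝ} (hs : 0 < s) {y : Space n} (hy : s⁻¹ < ‖y‖) :
    averagingKernelDeriv n s y = 0 := by
  have h1 : 1 < ‖s • y‖ ^ 2 := by
    rw [norm_smul, Real.norm_of_nonneg hs.le]
    have : 1 < s * ‖y‖ := by
      rw [inv_lt_iff_one_lt_mul₀ hs] at hy
      linarith
    nlinarith
  have h2 : bumpProfile =ᶠ[𝓝 (‖s • y‖ ^ 2)] fun _ => 0 := by
    filter_upwards [lt_mem_nhds h1] with t ht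
    exact bumpProfile_eq_zero ht.le
  rw [averagingKernelDeriv, h2.deriv_eq, h2.self_of_nhds]
  simp

theorem exists_averagingKernelDeriv_le (n : ℕ) {a b : ℝ} (ha : 0 < a) :
    ∃ C, ∀ s ∈ Set.Icc a b, ∀ y : Space n, |averagingKernelDeriv n s y| ≤ C := by
  obtain ⟨C, hC⟩ := ((isCompact_Icc (a := a) (b := b)).prod
    (isCompact_closedBall (0 : Space n) a⁻¹)).exists_bound_of_continuousOn
      (continuous_averagingKernelDeriv n).continuousOn
  refine ⟨max C 0, fun s hs y => ?_⟩
  by_cases hy : ‖y‖ ≤ a⁻¹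
  · exact (hC (s, y) ⟨hs, mem_closedBall_zero_iff.2 hy⟩).trans (le_max_left _ _)
  · have : s⁻¹ < ‖y‖ := (inv_anti₀ ha hs.1).trans_lt (not_le.1 hy)
    rw [averagingKernelDeriv_eq_zero (ha.trans_le hs.1) this, abs_zero]
    exact le_max_right _ _

/-- The derivative of an average in `s` is, up to a factor, the integral of `v` against the
Laplacian of `kernelPotential n s x`; it vanishes when that integral does. -/
theorem hasDerivAt_bumpAverage {v : Space n → ℝ} (hv : Integrable v) {s : ℝ} (hs : 0 < s)
    {x : Space n} (h0 : ∫ y, v y * (Δ (kernelPotential n s x)) y = 0) :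
    HasDerivAt (fun s => bumpAverage v s x) 0 s := by
  obtain ⟨C, hC⟩ := exists_averagingKernelDeriv_le n (a := s / 2) (b := 2 * s) (by linarith)
  have hkint : ∀ t, 0 < t → Integrable (fun y => averagingKernel n t (x - y) * v y) := by
    intro t ht
    obtain ⟨M, hM⟩ := (continuous_averagingKernel n t).bounded_above_of_compact_support
      (hasCompactSupport_averagingKernel n ht)
    exact hv.bdd_mul ((continuous_averagingKernel n t).comp
      (continuous_const.sub continuous_id)).aestronglyMeasurable
      (Eventually.of_forall fun y => hM (x - y))
  have hcd : Continuous fun y => averagingKernelDeriv n s (x - y) :=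
    (continuous_averagingKernelDeriv n).comp (by fun_prop : Continuous fun y => (s, x - y))
  have h := hasDerivAt_integral_of_dominated_loc_of_deriv_le (μ := (volume : Measure (Space n)))
    (F := fun s y => averagingKernel n s (x - y) * v y)
    (F' := fun s y => averagingKernelDeriv n s (x - y) * v y) (x₀ := s)
    (s := Set.Icc (s / 2) (2 * s)) (bound := fun y => C * |v y|)
    (Icc_mem_nhds (by linarith) (by linarith))
    ((eventually_gt_nhds hs).mono fun t ht => (hkint t ht).aestronglyMeasurable)
    (hkint s hs) (hcd.aestronglyMeasurable.mul hv.aestronglyMeasurable)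
    (Eventually.of_forall fun y t ht => by
      rw [norm_mul]
      exact mul_le_mul_of_nonneg_right (hC t ht _) (norm_nonneg _))
    (hv.norm.const_mul C)
    (Eventually.of_forall fun y t ht => (hasDerivAt_averagingKernel t (x - y)).mul_const (v y))
  refine h.2.congr_deriv ?_
  have e : ∀ y, averagingKernelDeriv n s (x - y) * v y
      = (s ^ 3)⁻¹ * s ^ n * (v y * (Δ (kernelPotential n s x)) y) := by
    intro y
    have := laplacian_kernelPotential s x y
    field_simp
    linear_combination (-v y) * this
  simp only [e, integral_const_mul, h0, mul_zero]

/-- Weakly harmonic on a set: `∫ u Δφ = 0` for every smooth `φ` with compact support in the set. -/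
def WeaklyHarmonicOn (u : Space n → ℝ) (U : Set (Space n)) : Prop :=
  ∀ φ : Space n → ℝ, ContDiff ℝ ∞ φ → HasCompactSupport φ → tsupport φ ⊆ U →
    ∫ x, u x * (Δ φ) x = 0

theorem bumpAverage_eq_of_eqOn {u v : Space n → ℝ} {x : Space n} {r : ℝ}
    (h : Set.EqOn u v (closedBall x r)) {s : ℝ} (hs : 0 < s) (hsr : s⁻¹ ≤ r) :
    bumpAverage u s x = bumpAverage v s x := by
  refine integral_congr_ae (Eventually.of_forall fun y => ?_)
  by_cases hy : y ∈ closedBall x r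
  · simp only [h hy]
  · rw [mem_closedBall, not_le, dist_comm, dist_eq_norm] at hy
    simp only [averagingKernel_eq_zero hs (hsr.trans hy.le), zero_mul]

/-- The averages of a weakly harmonic function do not depend on the radius. -/
theorem WeaklyHarmonicOn.bumpAverage_eq {u : Space n → ℝ} {U : Set (Space n)}
    (hu : WeaklyHarmonicOn u U) {x : Space n} {r : ℝ} (hr : 0 < r)
    (hxr : closedBall x r ⊆ U) (hint : IntegrableOn u (closedBall x r)) {s t : ℝ}
    (hs : r⁻¹ < s) (ht : r⁻¹ < t) : bumpAverage u s x = bumpAverage u t x := by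
  -- `u` need not be measurable off the ball, so it is replaced by its restriction to the ball.
  set v := (closedBall x r).indicator u with hv
  have hvi : Integrable v := hint.integrable_indicator measurableSet_closedBall
  have huv : Set.EqOn u v (closedBall x r) := fun y hy => (Set.indicator_of_mem hy u).symm
  have hr' : 0 < r⁻¹ := inv_pos.2 hr
  have key : ∀ s ∈ Set.Ioi r⁻¹, HasDerivAt (fun s => bumpAverage v s x) 0 s := by
    intro s hs
    have hs0 : 0 < s := hr'.trans hs
    have hsub : closedBall x s⁻¹ ⊆ closedBall x r :=
      closedBall_subset_closedBall (inv_le_of_inv_le₀ hr (le_of_lt hs))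
    refine hasDerivAt_bumpAverage hvi hs0 ?_
    rw [← hu _ (contDiff_kernelPotential s x) (hasCompactSupport_kernelPotential hs0 x)
      ((tsupport_kernelPotential_subset hs0 x).trans (hsub.trans hxr))]
    refine integral_congr_ae (Eventually.of_forall fun y => ?_)
    by_cases hy : y ∈ closedBall x r
    · simp only [huv hy]
    · have : (Δ (kernelPotential n s x)) y = 0 := laplacian_eq_zero_of_notMem_tsupport
        fun h => hy (hsub (tsupport_kernelPotential_subset hs0 x h))
      simp only [this, mul_zero]
  rw [bumpAverage_eq_of_eqOn huv (hr'.trans hs) (inv_le_of_inv_le₀ hr (le_of_lt hs)),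
    bumpAverage_eq_of_eqOn huv (hr'.trans ht) (inv_le_of_inv_le₀ hr (le_of_lt ht))]
  exact isOpen_Ioi.is_const_of_deriv_eq_zero isPreconnected_Ioi
    (fun s hs => (key s hs).differentiableAt.differentiableWithinAt)
    (fun s hs => (key s hs).deriv) hs ht

theorem tendsto_norm_pow_mul_radialBump (n : ℕ) :
    Tendsto (fun x : Space n => ‖x‖ ^ n * radialBump n x) (Bornology.cobounded (Space n))
      (𝓝 0) := by
  refine tendsto_const_nhds.congr' ?_
  filter_upwards [tendsto_norm_cobounded_atTop.eventually (eventually_ge_atTop 1)] with x hx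
  rw [radialBump_eq_zero hx, mul_zero]

theorem tendsto_bumpAverage_of_continuousAt {v : Space n → ℝ} (hv : Integrable v) {x : Space n}
    (hx : ContinuousAt v x) : Tendsto (fun s => bumpAverage v s x) atTop (𝓝 (v x)) := by
  have h := tendsto_integral_comp_smul_smul_of_integrable' (μ := (volume : Measure (Space n)))
    (φ := radialBump n) radialBump_nonneg (integral_radialBump n)
    (by simpa using tendsto_norm_pow_mul_radialBump n) hv hx
  simpa [bumpAverage, averagingKernel] using h

/-- Convergence at Lebesgue points. -/
theorem ae_tendsto_bumpAverage {v : Space n → ℝ} (hv : Integrable v) :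
    ∀ᵐ x, Tendsto (fun s => bumpAverage v s x) atTop (𝓝 (v x)) := by
  obtain ⟨M, hM⟩ := contDiff_radialBump.continuous.bounded_above_of_compact_support
    (hasCompactSupport_radialBump n)
  filter_upwards [(Besicovitch.vitaliFamily volume).ae_tendsto_average_norm_sub
    hv.locallyIntegrable] with x hx
  have hr : Tendsto (fun s : ℝ => s⁻¹) atTop (𝓝[>] 0) := tendsto_inv_atTop_nhdsGT_zero
  have h := (hx.comp (Besicovitch.tendsto_filterAt volume x)).comp hr
  refine tendsto_integral_smul_of_tendsto_average_norm_sub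
    (g := fun s y => averagingKernel n s (x - y))
    (M * (volume : Measure (Space n)).real (ball 0 1)) h ?_ ?_ ?_ ?_
  · exact Eventually.of_forall fun s => hv.integrableOn
  · refine tendsto_const_nhds.congr' ?_
    filter_upwards [eventually_gt_atTop 0] with s hs
    rw [integral_sub_left_eq_self (fun y => averagingKernel n s y), integral_averagingKernel n hs]
  · filter_upwards [eventually_gt_atTop 0] with s hs y hy
    by_contra h
    rw [mem_closedBall, not_le, dist_comm, dist_eq_norm] at h
    exact hy (averagingKernel_eq_zero hs h.le)
  · filter_upwards [eventually_gt_atTop 0] with s hs y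
    have hvol : 0 < (volume : Measure (Space n)).real (ball 0 1) :=
      ENNReal.toReal_pos (measure_ball_pos _ _ one_pos).ne' measure_ball_lt_top.ne
    rw [Measure.addHaar_real_closedBall _ _ (inv_pos.2 hs).le, finrank_euclideanSpace_fin,
      averagingKernel, abs_mul, abs_of_pos (pow_pos hs n)]
    have := hM (s • (x - y))
    rw [Real.norm_eq_abs] at this
    rw [mul_div_mul_right _ _ hvol.ne', inv_pow, div_inv_eq_mul, mul_comm]
    gcongr

theorem continuous_bumpAverage {v : Space n → ℝ} (hv : Integrable v) {s : ℝ} (hs : 0 < s) :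
    Continuous (bumpAverage v s) := by
  obtain ⟨M, hM⟩ := (continuous_averagingKernel n s).bounded_above_of_compact_support
    (hasCompactSupport_averagingKernel n hs)
  refine continuous_of_dominated (bound := fun y => M * ‖v y‖) (fun x => ?_) (fun x => ?_)
    (hv.norm.const_mul M) ?_
  · exact (((continuous_averagingKernel n s).comp
      (continuous_const.sub continuous_id)).aestronglyMeasurable).mul hv.aestronglyMeasurable
  · refine Eventually.of_forall fun y => ?_
    rw [norm_mul]
    exact mul_le_mul_of_nonneg_right (hM _) (norm_nonneg _)
  · exact Eventually.of_forall fun y => ((continuous_averagingKernel n s).comp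
      (continuous_id.sub continuous_const)).mul continuous_const

/-! ### Weyl's lemma and the local maximum principle -/

theorem two_le_infty : (2 : WithTop ℕ∞) ≤ ∞ :=
  WithTop.coe_le_coe.2 (le_top : (2 : ℕ∞) ≤ ⊤)

theorem integrable_mul_laplacian {u φ : Space n → ℝ} {U : Set (Space n)}
    (hu : LocallyIntegrableOn u U) (hφ : ContDiff ℝ 2 φ) (hc : HasCompactSupport φ)
    (hs : tsupport φ ⊆ U) : Integrable (fun x => u x * (Δ φ) x) := by
  have h1 : IntegrableOn (fun x => u x * (Δ φ) x) (tsupport φ) :=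
    (hu.integrableOn_compact_subset hs hc).mul_continuousOn
      (continuous_laplacian hφ).continuousOn hc
  refine (integrableOn_iff_integrable_of_support_subset fun x hx => ?_).1 h1
  by_contra h
  exact hx (by simp [laplacian_eq_zero_of_notMem_tsupport h])

theorem WeaklyHarmonicOn.mono {u : Space n → ℝ} {U V : Set (Space n)}
    (hu : WeaklyHarmonicOn u U) (h : V ⊆ U) : WeaklyHarmonicOn u V :=
  fun φ h1 h2 h3 => hu φ h1 h2 (h3.trans h)

theorem WeaklyHarmonicOn.add_const_mul {u v : Space n → ℝ} {U : Set (Space n)}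
    (hu : WeaklyHarmonicOn u U) (hv : WeaklyHarmonicOn v U) (hui : LocallyIntegrableOn u U)
    (hvi : LocallyIntegrableOn v U) (c : ℝ) : WeaklyHarmonicOn (fun x => u x + c * v x) U := by
  intro φ h1 h2 h3
  have h1' : ContDiff ℝ 2 φ := h1.of_le two_le_infty
  have e : ∀ x, (u x + c * v x) * (Δ φ) x = u x * (Δ φ) x + c * (v x * (Δ φ) x) := fun x => by
    ring
  simp only [e]
  rw [integral_add (integrable_mul_laplacian hui h1' h2 h3)
    ((integrable_mul_laplacian hvi h1' h2 h3).const_mul c), integral_const_mul, hu φ h1 h2 h3,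
    hv φ h1 h2 h3]
  simp

theorem WeaklyHarmonicOn.congr_ae {u v : Space n → ℝ} {U : Set (Space n)}
    (hu : WeaklyHarmonicOn u U) (h : ∀ᵐ x, x ∈ U → u x = v x) : WeaklyHarmonicOn v U := by
  intro φ h1 h2 h3
  rw [← hu φ h1 h2 h3]
  refine integral_congr_ae ?_
  filter_upwards [h] with x hx
  by_cases hxU : x ∈ U
  · rw [hx hxU]
  · rw [laplacian_eq_zero_of_notMem_tsupport fun h => hxU (h3 h), mul_zero, mul_zero]

/-- **Weyl's lemma**: a weakly harmonic function agrees almost everywhere with a continuous one,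
namely with the common value of its averages over small balls. -/
theorem WeaklyHarmonicOn.exists_continuousOn {u : Space n → ℝ} {U : Set (Space n)}
    (hU : IsOpen U) (hu : WeaklyHarmonicOn u U) (hui : LocallyIntegrableOn u U) :
    ∃ h : Space n → ℝ, ContinuousOn h U ∧ ∀ᵐ x, x ∈ U → u x = h x := by
  -- The averages at `x` are eventually constant, so this limit exists.
  let h : Space n → ℝ := fun x => limUnder atTop fun s => bumpAverage u s x
  have loc : ∀ x₀ ∈ U, ∃ r > 0, ∃ g : Space n → ℝ, Continuous g ∧ Set.EqOn h g (ball x₀ r) ∧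
      ∀ᵐ x, x ∈ ball x₀ r → u x = g x := by
    intro x₀ hx₀
    obtain ⟨ρ, hρ, hρU⟩ := Metric.nhds_basis_closedBall.mem_iff.1 (hU.mem_nhds hx₀)
    set r := ρ / 2 with hr
    have hr0 : 0 < r := by positivity
    set v := (closedBall x₀ ρ).indicator u with hv
    have hvi : Integrable v := (hui.integrableOn_compact_subset hρU
      (isCompact_closedBall _ _)).integrable_indicator measurableSet_closedBall
    have huv : Set.EqOn u v (closedBall x₀ ρ) := fun y hy => (Set.indicator_of_mem hy u).symm
    have hs1 : r⁻¹ < 2 * r⁻¹ := by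
      have := inv_pos.2 hr0
      linarith
    have hs0 : 0 < 2 * r⁻¹ := (inv_pos.2 hr0).trans hs1
    have hsub : ∀ x ∈ ball x₀ r, closedBall x r ⊆ closedBall x₀ ρ := fun x hx =>
      closedBall_subset_closedBall' (by
        have := mem_ball.1 hx
        linarith)
    have hconst : ∀ x ∈ ball x₀ r, ∀ s, r⁻¹ < s →
        bumpAverage u s x = bumpAverage v (2 * r⁻¹) x := by
      intro x hx s hs
      rw [hu.bumpAverage_eq hr0 ((hsub x hx).trans hρU)
        (hui.integrableOn_compact_subset ((hsub x hx).trans hρU) (isCompact_closedBall _ _)) hs hs1]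
      exact bumpAverage_eq_of_eqOn (huv.mono (hsub x hx)) hs0 (inv_le_of_inv_le₀ hr0 hs1.le)
    refine ⟨r, hr0, bumpAverage v (2 * r⁻¹), continuous_bumpAverage hvi hs0, ?_, ?_⟩
    · intro x hx
      refine Tendsto.limUnder_eq (tendsto_const_nhds.congr' ?_)
      filter_upwards [eventually_gt_atTop r⁻¹] with s hs
      exact (hconst x hx s hs).symm
    · filter_upwards [ae_tendsto_bumpAverage hvi] with x hx hxr
      have hxρ : x ∈ closedBall x₀ ρ := hsub x hxr (mem_closedBall_self hr0.le)
      rw [huv hxρ]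
      refine tendsto_nhds_unique hx (tendsto_const_nhds.congr' ?_)
      filter_upwards [eventually_gt_atTop r⁻¹] with s hs
      rw [← hconst x hxr s hs]
      exact bumpAverage_eq_of_eqOn (huv.mono (hsub x hxr)) ((inv_pos.2 hr0).trans hs)
        (inv_le_of_inv_le₀ hr0 hs.le)
  refine ⟨h, fun x hx => ?_, ?_⟩
  · obtain ⟨r, hr, g, hg, hgh, -⟩ := loc x hx
    have : h =ᶠ[𝓝 x] g := hgh.eventuallyEq_of_mem (ball_mem_nhds x hr)
    exact (hg.continuousAt.congr this.symm).continuousWithinAt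
  · have : (volume : Measure (Space n)) {x | x ∈ U ∧ u x ≠ h x} = 0 := by
      refine measure_null_of_locally_null _ fun x hx => ?_
      obtain ⟨r, hr, g, -, hgh, hgu⟩ := loc x hx.1
      refine ⟨ball x r ∩ {x | x ∈ U ∧ u x ≠ h x}, ?_, ?_⟩
      · rw [Set.inter_comm]
        exact inter_mem_nhdsWithin _ (ball_mem_nhds x hr)
      · refine measure_mono_null (fun y hy => ?_) (ae_iff.1 hgu)
        exact fun hyg => hy.2.2 ((hyg hy.1).trans (hgh hy.1).symm)
    rw [ae_iff]
    simpa only [Classical.not_imp] using this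

/-- A continuous weakly harmonic function with a maximum at the centre of a ball is constant on that
ball, because its value at the centre is a weighted average with positive weights. -/
theorem WeaklyHarmonicOn.eq_of_le {u : Space n → ℝ} {U : Set (Space n)}
    (hu : WeaklyHarmonicOn u U) (huc : ContinuousOn u U) {x : Space n} {r : ℝ} (hr : 0 < r)
    (hxr : closedBall x r ⊆ U) (hle : ∀ y ∈ closedBall x r, u y ≤ u x) :
    ∀ y ∈ ball x r, u y = u x := by
  intro y hy
  have hint : IntegrableOn u (closedBall x r) :=
    (huc.mono hxr).integrableOn_compact (isCompact_closedBall _ _)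
  set v := (closedBall x r).indicator u with hv
  have hvi : Integrable v := hint.integrable_indicator measurableSet_closedBall
  have huv : Set.EqOn u v (closedBall x r) := fun y hy => (Set.indicator_of_mem hy u).symm
  have hr' : 0 < r⁻¹ := inv_pos.2 hr
  obtain ⟨ρ, hρ1, hρ2⟩ := exists_between (mem_ball.1 hy)
  have hρ0 : 0 < ρ := dist_nonneg.trans_lt hρ1
  have hs : r⁻¹ < ρ⁻¹ := inv_strictAnti₀ hρ0 hρ2
  have hs0 : 0 < ρ⁻¹ := inv_pos.2 hρ0
  have hxx : x ∈ closedBall x r := mem_closedBall_self hr.le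
  have hvx : ContinuousAt v x := by
    have h1 : ContinuousAt u x := (huc.mono hxr).continuousAt (closedBall_mem_nhds x hr)
    exact h1.congr (huv.eventuallyEq_of_mem (closedBall_mem_nhds x hr))
  have havg : bumpAverage v ρ⁻¹ x = u x := by
    rw [huv hxx]
    refine tendsto_nhds_unique (tendsto_const_nhds.congr' ?_)
      (tendsto_bumpAverage_of_continuousAt hvi hvx)
    filter_upwards [eventually_gt_atTop r⁻¹] with s hs'
    rw [← bumpAverage_eq_of_eqOn huv hs0 (inv_le_of_inv_le₀ hr hs.le),
      ← bumpAverage_eq_of_eqOn huv (hr'.trans hs') (inv_le_of_inv_le₀ hr hs'.le)]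
    exact hu.bumpAverage_eq hr hxr hint hs hs'
  have hk : Continuous fun y => averagingKernel n ρ⁻¹ (x - y) :=
    (continuous_averagingKernel n ρ⁻¹).comp (by fun_prop)
  have hk1 : ∫ y, averagingKernel n ρ⁻¹ (x - y) = 1 := by
    rw [integral_sub_left_eq_self (fun y => averagingKernel n ρ⁻¹ y),
      integral_averagingKernel n hs0]
  have hki : Integrable fun y => averagingKernel n ρ⁻¹ (x - y) := integrable_of_integral_eq_one hk1
  have hkv : Integrable fun y => averagingKernel n ρ⁻¹ (x - y) * v y := by
    obtain ⟨M, hM⟩ := (continuous_averagingKernel n ρ⁻¹).bounded_above_of_compact_support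
      (hasCompactSupport_averagingKernel n hs0)
    exact hvi.bdd_mul hk.aestronglyMeasurable (Eventually.of_forall fun y => hM (x - y))
  have hnn : ∀ y,
      0 ≤ averagingKernel n ρ⁻¹ (x - y) * u x - averagingKernel n ρ⁻¹ (x - y) * v y := by
    intro y
    by_cases hy : y ∈ closedBall x r
    · rw [← huv hy, ← mul_sub]
      exact mul_nonneg (averagingKernel_nonneg hs0 _) (sub_nonneg.2 (hle y hy))
    · rw [mem_closedBall, not_le, dist_comm, dist_eq_norm] at hy
      rw [averagingKernel_eq_zero hs0 (by rw [inv_inv]; exact hρ2.le.trans hy.le)]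
      simp
  have hzero : ∫ y, (averagingKernel n ρ⁻¹ (x - y) * u x - averagingKernel n ρ⁻¹ (x - y) * v y)
      = 0 := by
    rw [integral_sub (hki.mul_const _) hkv, integral_mul_const, hk1, one_mul, sub_eq_zero]
    exact havg.symm
  have hae := (integral_eq_zero_iff_of_nonneg hnn ((hki.mul_const _).sub hkv)).1 hzero
  have hball : ball x ρ ⊆ closedBall x r := (ball_subset_ball hρ2.le).trans ball_subset_closedBall
  refine Measure.eqOn_open_of_ae_eq (μ := (volume : Measure (Space n))) (U := ball x ρ)
    (f := u) (g := fun _ => u x) ?_ isOpen_ball (huc.mono (hball.trans hxr))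
    continuousOn_const hρ1
  rw [EventuallyEq, ae_restrict_iff' measurableSet_ball]
  filter_upwards [hae] with w hw hwρ
  have hpos : 0 < averagingKernel n ρ⁻¹ (x - w) := by
    refine averagingKernel_pos hs0 ?_
    rw [inv_inv, ← dist_eq_norm, dist_comm]
    exact hwρ
  simp only [Pi.zero_apply] at hw
  rw [← mul_sub, ← huv (hball hwρ)] at hw
  have := (mul_eq_zero.1 hw).resolve_left hpos.ne'
  linarith

/-! ### The correction term -/

/-- The function `g(y) = (y · e - 1) / |y - e|ⁿ`, so that the integrand of the correction is
`(g(s x) + 1) / s` with `e = z / |z|`. -/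
noncomputable def dipole (n : ℕ) (e y : Space n) : ℝ := (⟪y, e⟫ - 1) / ‖y - e‖ ^ n

theorem dipole_zero {e : Space n} (he : ‖e‖ = 1) : dipole n e 0 = -1 := by
  simp [dipole, he]

theorem ne_of_norm_lt_one {e y : Space n} (he : ‖e‖ = 1) (hy : ‖y‖ < 1) : y - e ≠ 0 := by
  rw [sub_ne_zero]
  rintro rfl
  linarith

theorem contDiffOn_dipole {e : Space n} (he : ‖e‖ = 1) :
    ContDiffOn ℝ 1 (dipole n e) (ball 0 1) := by
  intro y hy
  have h := ne_of_norm_lt_one he (mem_ball_zero_iff.1 hy)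
  refine ContDiffAt.contDiffWithinAt ?_
  unfold dipole
  refine ((contDiffAt_id.inner ℝ contDiffAt_const).sub contDiffAt_const).div ?_
    (pow_ne_zero n (norm_ne_zero_iff.2 h))
  exact ((contDiffAt_id.sub contDiffAt_const).norm ℝ h).pow n

theorem hasFDerivAt_dipole {e : Space n} (he : ‖e‖ = 1) {y : Space n} (hy : ‖y‖ < 1) :
    HasFDerivAt (dipole n e) (fderiv ℝ (dipole n e) y) y :=
  (((contDiffOn_dipole he).contDiffAt
    (isOpen_ball.mem_nhds (mem_ball_zero_iff.2 hy))).differentiableAt one_ne_zero).hasFDerivAt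

theorem continuousOn_fderiv_dipole {e : Space n} (he : ‖e‖ = 1) :
    ContinuousOn (fderiv ℝ (dipole n e)) (ball 0 1) :=
  (contDiffOn_dipole he).continuousOn_fderiv_of_isOpen isOpen_ball le_rfl

theorem exists_fderiv_dipole_le {e : Space n} (he : ‖e‖ = 1) {ρ : ℝ} (hρ : ρ < 1) :
    ∃ C, 0 ≤ C ∧ ∀ y ∈ closedBall (0 : Space n) ρ, ‖fderiv ℝ (dipole n e) y‖ ≤ C := by
  obtain ⟨C, hC⟩ := (isCompact_closedBall (0 : Space n) ρ).exists_bound_of_continuousOn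
    ((continuousOn_fderiv_dipole he).mono (closedBall_subset_ball hρ))
  exact ⟨max C 0, le_max_right _ _, fun y hy => (hC y hy).trans (le_max_left _ _)⟩

theorem norm_direction {z : Space n} (hz : z ≠ 0) : ‖‖z‖⁻¹ • z‖ = 1 := by
  rw [norm_smul, norm_inv, norm_norm, inv_mul_cancel₀ (norm_ne_zero_iff.2 hz)]

theorem greenIntegrand_eq (z x : Space n) {s : ℝ} (hs : s ≠ 0) :
    greenIntegrand n z x s = s⁻¹ * (dipole n (‖z‖⁻¹ • z) (s • x) + 1) := by
  rw [greenIntegrand, dipole, real_inner_smul_left, mul_add, mul_one, ← mul_div_assoc, mul_sub,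
    inv_mul_cancel_left₀ hs, mul_one, one_div]

theorem hasFDerivAt_greenIntegrand {z x : Space n} (hz : z ≠ 0) {s : ℝ} (hs : 0 < s)
    (hsx : ‖s • x‖ < 1) :
    HasFDerivAt (fun x => greenIntegrand n z x s) (fderiv ℝ (dipole n (‖z‖⁻¹ • z)) (s • x)) x := by
  simp only [greenIntegrand_eq z _ hs.ne']
  have h1 : HasFDerivAt (fun x : Space n => s • x) (s • ContinuousLinearMap.id ℝ (Space n)) x :=
    (hasFDerivAt_id x).const_smul s
  have h2 := ((hasFDerivAt_dipole (norm_direction hz) hsx).comp x h1).add_const 1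
  refine (h2.const_mul s⁻¹).congr_fderiv ?_
  ext v
  simp [hs.ne']

theorem norm_smul_le_of_mem {a R s : ℝ} {x : Space n} (hs : s ∈ Set.Icc 0 a) (hx : ‖x‖ ≤ R) :
    ‖s • x‖ ≤ a * R := by
  rw [norm_smul, Real.norm_of_nonneg hs.1]
  exact mul_le_mul hs.2 hx (norm_nonneg x) (hs.1.trans hs.2)

/-- The singularity `1 / s` of the integrand at `s = 0` is removable: `g(0) = -1`, so the mean value
inequality bounds `(g(s x) + 1) / s`. -/
theorem exists_greenIntegrand_le {z : Space n} (hz : z ≠ 0) {R : ℝ} (hR : ‖z‖ * R < 1) :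
    ∃ C, ∀ s ∈ Set.Ioc 0 ‖z‖, ∀ x, ‖x‖ ≤ R → |greenIntegrand n z x s| ≤ C := by
  have he := norm_direction hz
  obtain ⟨C, hC0, hC⟩ := exists_fderiv_dipole_le he hR
  refine ⟨C * R, fun s hs x hx => ?_⟩
  have hmem : s • x ∈ closedBall (0 : Space n) (‖z‖ * R) :=
    mem_closedBall_zero_iff.2 (norm_smul_le_of_mem ⟨hs.1.le, hs.2⟩ hx)
  have h0 : (0 : Space n) ∈ closedBall (0 : Space n) (‖z‖ * R) :=
    mem_closedBall_self ((norm_nonneg _).trans (mem_closedBall_zero_iff.1 hmem))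
  have h := (convex_closedBall (0 : Space n) (‖z‖ * R)).norm_image_sub_le_of_norm_hasFDerivWithin_le
    (fun y hy => (hasFDerivAt_dipole he
      ((mem_closedBall_zero_iff.1 hy).trans_lt hR)).hasFDerivWithinAt) hC h0 hmem
  rw [dipole_zero he, sub_neg_eq_add, sub_zero, norm_smul, Real.norm_of_nonneg hs.1.le] at h
  rw [greenIntegrand_eq z x hs.1.ne', abs_mul, abs_inv, abs_of_pos hs.1, inv_mul_le_iff₀ hs.1]
  calc |dipole n (‖z‖⁻¹ • z) (s • x) + 1| ≤ C * (s * ‖x‖) := h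
    _ ≤ C * (s * R) := mul_le_mul_of_nonneg_left (mul_le_mul_of_nonneg_left hx hs.1.le) hC0
    _ = s * (C * R) := by ring

theorem measurable_greenIntegrand (z : Space n) :
    Measurable fun p : ℝ × Space n => greenIntegrand n z p.2 p.1 := by
  unfold greenIntegrand
  fun_prop

theorem exists_radius {z x : Space n} (hx : ‖z‖ * ‖x‖ < 1) : ∃ R, ‖x‖ < R ∧ ‖z‖ * R < 1 := by
  have h : ∀ᶠ R in 𝓝 ‖x‖, ‖z‖ * R < 1 :=
    (continuous_const.mul continuous_id).continuousAt.eventually (gt_mem_nhds hx)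
  obtain ⟨ε, hε, h'⟩ := Metric.eventually_nhds_iff.1 h
  refine ⟨‖x‖ + ε / 2, by linarith, h' ?_⟩
  rw [Real.dist_eq, add_sub_cancel_left, abs_of_pos (by positivity)]
  linarith

theorem intervalIntegrable_greenIntegrand {z x : Space n} (hx : ‖z‖ * ‖x‖ < 1) :
    IntervalIntegrable (greenIntegrand n z x) volume 0 ‖z‖ := by
  by_cases hz : z = 0
  · simp [hz]
  obtain ⟨C, hC⟩ := exists_greenIntegrand_le hz hx
  rw [intervalIntegrable_iff_integrableOn_Ioc_of_le (norm_nonneg z)]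
  refine Measure.integrableOn_of_bounded (M := C) measure_Ioc_lt_top.ne
    ((measurable_greenIntegrand z).comp measurable_prodMk_right).aestronglyMeasurable ?_
  rw [ae_restrict_iff' measurableSet_Ioc]
  exact Eventually.of_forall fun s hs => hC s hs x le_rfl

/-- The smooth part `∫₀^{|z|} ((x · z/|z| - 1/s) / |s x - z/|z||ⁿ + 1/s) ds` of `G_z`. -/
noncomputable def correction (n : ℕ) (z x : Space n) : ℝ :=
  ∫ s in (0 : ℝ)..‖z‖, greenIntegrand n z x s

/-- The derivative of the correction. The factor `1 / s` of the integrand cancels against the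
chain rule. -/
noncomputable def correctionDeriv (n : ℕ) (z x : Space n) : Space n →L[ℝ] ℝ :=
  ∫ s in (0 : ℝ)..‖z‖, fderiv ℝ (dipole n (‖z‖⁻¹ • z)) (s • x)

theorem continuousOn_fderiv_dipole_smul {z x : Space n} (hz : z ≠ 0) (hx : ‖z‖ * ‖x‖ < 1) :
    ContinuousOn (fun s : ℝ => fderiv ℝ (dipole n (‖z‖⁻¹ • z)) (s • x)) (Set.Icc 0 ‖z‖) :=
  (continuousOn_fderiv_dipole (norm_direction hz)).comp (by fun_prop) fun _ hs =>
    mem_ball_zero_iff.2 ((norm_smul_le_of_mem hs le_rfl).trans_lt hx)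

theorem hasFDerivAt_correction {z x : Space n} (hx : ‖z‖ * ‖x‖ < 1) :
    HasFDerivAt (correction n z) (correctionDeriv n z x) x := by
  by_cases hz : z = 0
  · subst hz
    have h1 : correction n (0 : Space n) = fun _ => 0 := by
      funext y
      simp [correction]
    have h2 : correctionDeriv n (0 : Space n) x = 0 := by simp [correctionDeriv]
    rw [h1, h2]
    exact hasFDerivAt_const _ _
  obtain ⟨R, hxR, hR⟩ := exists_radius hx
  obtain ⟨C, -, hC⟩ := exists_fderiv_dipole_le (norm_direction hz) hR
  refine intervalIntegral.hasFDerivAt_integral_of_dominated_of_fderiv_le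
    (F := fun x s => greenIntegrand n z x s)
    (F' := fun x s => fderiv ℝ (dipole n (‖z‖⁻¹ • z)) (s • x)) (s := ball 0 R) (bound := fun _ => C)
    (isOpen_ball.mem_nhds (mem_ball_zero_iff.2 hxR)) ?_ (intervalIntegrable_greenIntegrand hx) ?_ ?_
    intervalIntegrable_const ?_
  · exact Eventually.of_forall fun y =>
      ((measurable_greenIntegrand z).comp measurable_prodMk_right).aestronglyMeasurable
  · rw [Set.uIoc_of_le (norm_nonneg z)]
    exact ((continuousOn_fderiv_dipole_smul hz hx).mono
      Set.Ioc_subset_Icc_self).aestronglyMeasurable measurableSet_Ioc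
  · refine Eventually.of_forall fun s hs y hy => hC _ ?_
    rw [Set.uIoc_of_le (norm_nonneg z)] at hs
    exact mem_closedBall_zero_iff.2
      (norm_smul_le_of_mem ⟨hs.1.le, hs.2⟩ (mem_ball_zero_iff.1 hy).le)
  · refine Eventually.of_forall fun s hs y hy => ?_
    rw [Set.uIoc_of_le (norm_nonneg z)] at hs
    exact hasFDerivAt_greenIntegrand hz hs.1
      ((norm_smul_le_of_mem ⟨hs.1.le, hs.2⟩ (mem_ball_zero_iff.1 hy).le).trans_lt hR)

theorem continuousAt_correctionDeriv {z x : Space n} (hx : ‖z‖ * ‖x‖ < 1) :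
    ContinuousAt (correctionDeriv n z) x := by
  by_cases hz : z = 0
  · subst hz
    have : correctionDeriv n (0 : Space n) = fun _ => 0 := by
      funext y
      simp [correctionDeriv]
    rw [this]
    exact continuousAt_const
  obtain ⟨R, hxR, hR⟩ := exists_radius hx
  obtain ⟨C, -, hC⟩ := exists_fderiv_dipole_le (norm_direction hz) hR
  have hnhds : ∀ᶠ y in 𝓝 x, y ∈ ball (0 : Space n) R :=
    isOpen_ball.mem_nhds (mem_ball_zero_iff.2 hxR)
  refine intervalIntegral.continuousAt_of_dominated_interval (bound := fun _ => C) ?_ ?_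
    intervalIntegrable_const ?_
  · filter_upwards [hnhds] with y hy
    have hy' : ‖z‖ * ‖y‖ < 1 := (mul_le_mul_of_nonneg_left (mem_ball_zero_iff.1 hy).le
      (norm_nonneg z)).trans_lt hR
    rw [Set.uIoc_of_le (norm_nonneg z)]
    exact ((continuousOn_fderiv_dipole_smul hz hy').mono
      Set.Ioc_subset_Icc_self).aestronglyMeasurable measurableSet_Ioc
  · filter_upwards [hnhds] with y hy
    refine Eventually.of_forall fun s hs => hC _ ?_
    rw [Set.uIoc_of_le (norm_nonneg z)] at hs
    exact mem_closedBall_zero_iff.2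
      (norm_smul_le_of_mem ⟨hs.1.le, hs.2⟩ (mem_ball_zero_iff.1 hy).le)
  · refine Eventually.of_forall fun s hs => ?_
    rw [Set.uIoc_of_le (norm_nonneg z)] at hs
    have h1 := (continuousOn_fderiv_dipole (norm_direction hz)).continuousAt (isOpen_ball.mem_nhds
      (mem_ball_zero_iff.2 ((norm_smul_le_of_mem ⟨hs.1.le, hs.2⟩ le_rfl).trans_lt hx)))
    exact ContinuousAt.comp (f := fun y : Space n => s • y) h1 (by fun_prop)

theorem contDiffAt_correction {z x : Space n} (hx : ‖z‖ * ‖x‖ < 1) :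
    ContDiffAt ℝ 1 (correction n z) x := by
  have hopen : ∀ᶠ y in 𝓝 x, ‖z‖ * ‖y‖ < 1 :=
    (continuous_const.mul continuous_norm).continuousAt.eventually (gt_mem_nhds hx)
  rw [contDiffAt_one_iff]
  refine ⟨correctionDeriv n z, {y | ‖z‖ * ‖y‖ < 1}, hopen, fun y hy => ?_, fun y hy => ?_⟩
  · exact (continuousAt_correctionDeriv hy).continuousWithinAt
  · exact hasFDerivAt_correction hy

/-- The radial derivative of the correction is `∫ d/ds g(s x) ds`, computed by the fundamental
theorem of calculus. -/
theorem correctionDeriv_apply_self {z x : Space n} (hz : z ≠ 0) (hx : ‖z‖ * ‖x‖ < 1) :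
    correctionDeriv n z x x = dipole n (‖z‖⁻¹ • z) (‖z‖ • x) + 1 := by
  have he := norm_direction hz
  have hc := continuousOn_fderiv_dipole_smul hz hx
  have hi : IntervalIntegrable (fun s : ℝ => fderiv ℝ (dipole n (‖z‖⁻¹ • z)) (s • x))
      volume 0 ‖z‖ :=
    ContinuousOn.intervalIntegrable (by rwa [Set.uIcc_of_le (norm_nonneg z)])
  have hi' : IntervalIntegrable (fun s : ℝ => fderiv ℝ (dipole n (‖z‖⁻¹ • z)) (s • x) x)
      volume 0 ‖z‖ :=
    ContinuousOn.intervalIntegrable (by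
      rw [Set.uIcc_of_le (norm_nonneg z)]
      exact hc.clm_apply continuousOn_const)
  rw [correctionDeriv, ContinuousLinearMap.intervalIntegral_apply hi,
    intervalIntegral.integral_eq_sub_of_hasDerivAt
      (f := fun s : ℝ => dipole n (‖z‖⁻¹ • z) (s • x)) (fun s hs => ?_) hi', zero_smul,
    dipole_zero he, sub_neg_eq_add]
  rw [Set.uIcc_of_le (norm_nonneg z)] at hs
  have h1 : HasDerivAt (fun s : ℝ => s • x) x s := by
    simpa using (hasDerivAt_id s).smul_const x
  exact (hasFDerivAt_dipole he ((norm_smul_le_of_mem hs le_rfl).trans_lt hx)).comp_hasDerivAt s h1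

/-! ### Weak harmonicity of the correction -/

theorem integral_laplacian_eq_zero {φ : Space n → ℝ} (hφ : ContDiff ℝ 2 φ)
    (hc : HasCompactSupport φ) : ∫ x, (Δ φ) x = 0 := by
  have h := integral_mul_laplacian_eq (f := fun _ => (1 : ℝ)) contDiff_const hφ hc
  simpa using h

/-- The derivative of `Φ(· - t e)` in the direction `e` is weakly harmonic in the unit ball when
`t > 1`: differentiate `∫ Φ(x - t e) Δφ(x) dx = φ(t e) = 0` in `t`. -/
theorem integral_deriv_fundamentalSolution_mul_laplacian (hn : 1 ≤ n) {e : Space n} (he : ‖e‖ = 1)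
    {t : ℝ} (ht : 1 < t) {φ : Space n → ℝ} (hφ : ContDiff ℝ 2 φ) (hc : HasCompactSupport φ)
    (hs : tsupport φ ⊆ ball 0 1) :
    ∫ x, ⟪x - t • e, e⟫ / ‖x - t • e‖ ^ n * (Δ φ) x = 0 := by
  have hω := surfaceArea_pos hn
  have hΔ := continuous_laplacian hφ
  have hΔc := hasCompactSupport_laplacian hc
  have hΔs : ∀ x, x ∉ ball (0 : Space n) 1 → (Δ φ) x = 0 := fun x hx =>
    laplacian_eq_zero_of_notMem_tsupport fun h => hx (hs h)
  set δ := (t - 1) / 2 with hδ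
  have hδ0 : 0 < δ := by
    rw [hδ]
    linarith
  have hnorm : ∀ τ ∈ ball t δ, ∀ x ∈ ball (0 : Space n) 1,
      δ ≤ ‖x - τ • e‖ ∧ ‖x - τ • e‖ ≤ t + δ + 1 := by
    intro τ hτ x hx
    rw [mem_ball, Real.dist_eq, abs_lt] at hτ
    rw [mem_ball_zero_iff] at hx
    have h1 : ‖τ • e‖ = τ := by
      rw [norm_smul, he, mul_one, Real.norm_of_nonneg (by linarith)]
    constructor
    · have := norm_sub_norm_le (τ • e) x
      rw [norm_sub_rev, h1] at this
      linarith
    · have := norm_sub_le x (τ • e)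
      linarith
  have hloc : ∀ τ : ℝ, Integrable fun x => fundamentalSolution n (x - τ • e) * (Δ φ) x := by
    intro τ
    have h1 := (locallyIntegrable_fundamentalSolution hn).integrable_smul_right_of_hasCompactSupport
      (g := fun x => (Δ φ) (x + τ • e)) (hΔ.comp (by fun_prop))
      (hΔc.comp_homeomorph (Homeomorph.addRight (τ • e)))
    simpa using h1.comp_sub_right (τ • e)
  have h := hasDerivAt_integral_of_dominated_loc_of_deriv_le (μ := (volume : Measure (Space n)))
    (F := fun τ x => fundamentalSolution n (x - τ • e) * (Δ φ) x)
    (F' := fun τ x => -(1 / surfaceArea n) *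
      (⟪x - τ • e, e⟫ / ‖x - τ • e‖ ^ n * (Δ φ) x)) (x₀ := t)
    (s := ball t δ) (bound := fun x => 1 / surfaceArea n * ((t + δ + 1) / δ ^ n * |(Δ φ) x|))
    (ball_mem_nhds t hδ0) (Eventually.of_forall fun τ => (hloc τ).aestronglyMeasurable)
    (hloc t) ?_ ?_ ?_ ?_
  · have hzero : ∀ τ ∈ ball t δ, ∫ x, fundamentalSolution n (x - τ • e) * (Δ φ) x = 0 := by
      intro τ hτ
      rw [integral_fundamentalSolution_mul_laplacian hn hφ hc]
      refine image_eq_zero_of_notMem_tsupport fun hmem => ?_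
      have h1 := mem_ball_zero_iff.1 (hs hmem)
      rw [mem_ball, Real.dist_eq, abs_lt] at hτ
      rw [norm_smul, he, mul_one, Real.norm_of_nonneg (by linarith)] at h1
      linarith
    have h0 : HasDerivAt (fun τ => ∫ x, fundamentalSolution n (x - τ • e) * (Δ φ) x) 0 t :=
      (hasDerivAt_const t (0 : ℝ)).congr_of_eventuallyEq
        (Filter.eventuallyEq_of_mem (ball_mem_nhds t hδ0) hzero)
    have h1 := h.2.unique h0
    rw [integral_const_mul] at h1
    exact (mul_eq_zero.1 h1).resolve_left (neg_ne_zero.2 (one_div_pos.2 hω).ne')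
  · have : Measurable fun x : Space n => ⟪x - t • e, e⟫ / ‖x - t • e‖ ^ n := by fun_prop
    exact ((this.aestronglyMeasurable).mul hΔ.aestronglyMeasurable).const_mul _
  · refine Eventually.of_forall fun x τ hτ => ?_
    by_cases hx : x ∈ ball (0 : Space n) 1
    · obtain ⟨h1, h2⟩ := hnorm τ hτ x hx
      rw [norm_mul, norm_mul, norm_neg, Real.norm_of_nonneg (one_div_pos.2 hω).le, norm_div,
        norm_pow, norm_norm, Real.norm_eq_abs, Real.norm_eq_abs]
      have h3 : |⟪x - τ • e, e⟫| ≤ t + δ + 1 := by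
        refine (abs_real_inner_le_norm _ _).trans ?_
        rw [he, mul_one]
        exact h2
      gcongr
    · simp [hΔs x hx]
  · exact ((hΔ.norm.integrable_of_hasCompactSupport hΔc.norm).const_mul _).const_mul _
  · refine Eventually.of_forall fun x τ hτ => ?_
    by_cases hx : x ∈ ball (0 : Space n) 1
    · have h1 := (hnorm τ hτ x hx).1
      have hne : x - τ • e ≠ 0 := norm_pos_iff.1 (hδ0.trans_le h1)
      have h2 : HasDerivAt (fun τ : ℝ => x - τ • e) (-e) τ := by
        simpa using ((hasDerivAt_id τ).smul_const e).const_sub x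
      have h3 := ((hasFDerivAt_fundamentalSolution hn hne).comp_hasDerivAt τ h2).mul_const ((Δ φ) x)
      refine h3.congr_deriv ?_
      have hp : ‖x - τ • e‖ ^ n ≠ 0 := pow_ne_zero n (norm_ne_zero_iff.2 hne)
      simp only [_root_.smul_apply, innerSL_apply_apply, inner_neg_right, smul_eq_mul]
      field_simp
    · simp only [hΔs x hx, mul_zero]
      exact hasDerivAt_const _ _

theorem integral_greenIntegrand_mul_laplacian (hn : 1 ≤ n) {z : Space n} (hz0 : z ≠ 0)
    {s : ℝ} (hs0 : 0 < s) (hs1 : s < 1) {φ : Space n → ℝ} (hφ : ContDiff ℝ 2 φ)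
    (hc : HasCompactSupport φ) (hs : tsupport φ ⊆ ball 0 1) :
    ∫ x, greenIntegrand n z x s * (Δ φ) x = 0 := by
  have he := norm_direction hz0
  set e := ‖z‖⁻¹ • z with hedef
  have hΔ := continuous_laplacian hφ
  have hΔc := hasCompactSupport_laplacian hc
  have hid : ∀ x, greenIntegrand n z x s * (Δ φ) x =
      (s ^ n)⁻¹ * (⟪x - s⁻¹ • e, e⟫ / ‖x - s⁻¹ • e‖ ^ n * (Δ φ) x) + 1 / s * (Δ φ) x := by
    intro x
    have h1 : s • x - e = s • (x - s⁻¹ • e) := by rw [smul_sub, smul_inv_smul₀ hs0.ne']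
    rw [greenIntegrand, ← hedef, h1, norm_smul, Real.norm_of_nonneg hs0.le, mul_pow, inner_sub_left,
      real_inner_smul_left, real_inner_self_eq_norm_sq, he, one_pow, mul_one, one_div]
    field_simp
  simp only [hid]
  have h2 := integral_deriv_fundamentalSolution_mul_laplacian hn he ((one_lt_inv₀ hs0).2 hs1)
    hφ hc hs
  have hI : Integrable fun x => ⟪x - s⁻¹ • e, e⟫ / ‖x - s⁻¹ • e‖ ^ n * (Δ φ) x := by
    have hcont : ContinuousOn (fun x : Space n => ⟪x - s⁻¹ • e, e⟫ / ‖x - s⁻¹ • e‖ ^ n)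
        (ball 0 1) := by
      refine ContinuousOn.div (by fun_prop) (by fun_prop) fun x hx => pow_ne_zero n ?_
      rw [norm_ne_zero_iff, sub_ne_zero]
      rintro rfl
      rw [mem_ball_zero_iff, norm_smul, he, mul_one, Real.norm_of_nonneg (inv_pos.2 hs0).le] at hx
      exact absurd hx (not_lt.2 ((one_lt_inv₀ hs0).2 hs1).le)
    exact integrable_mul_laplacian (hcont.locallyIntegrableOn measurableSet_ball) hφ hc hs
  rw [integral_add (hI.const_mul _) ((hΔ.integrable_of_hasCompactSupport hΔc).const_mul _),
    integral_const_mul, integral_const_mul, h2, integral_laplacian_eq_zero hφ hc]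
  simp

theorem continuousOn_correction {z : Space n} (hz : z ∈ ball (0 : Space n) 1) :
    ContinuousOn (correction n z) (closedBall 0 1) := by
  intro x hx
  have h : ‖z‖ * ‖x‖ < 1 := by
    rw [mem_ball_zero_iff] at hz
    rw [mem_closedBall_zero_iff] at hx
    nlinarith [norm_nonneg z, norm_nonneg x]
  exact (contDiffAt_correction h).continuousAt.continuousWithinAt

theorem integral_correction_mul_laplacian (hn : 1 ≤ n) {z : Space n}
    (hz : z ∈ ball (0 : Space n) 1) {φ : Space n → ℝ} (hφ : ContDiff ℝ 2 φ)
    (hc : HasCompactSupport φ) (hs : tsupport φ ⊆ ball 0 1) :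
    ∫ x, correction n z x * (Δ φ) x = 0 := by
  by_cases hz0 : z = 0
  · simp [correction, hz0]
  rw [mem_ball_zero_iff] at hz
  have hΔ := continuous_laplacian hφ
  have hΔc := hasCompactSupport_laplacian hc
  obtain ⟨C, hC⟩ := exists_greenIntegrand_le hz0 (R := 1) (by rwa [mul_one])
  have hint : Integrable (Function.uncurry fun (x : Space n) (s : ℝ) =>
      greenIntegrand n z x s * (Δ φ) x) (volume.prod (volume.restrict (Set.Ioc 0 ‖z‖))) := by
    have hb : Integrable (fun p : Space n × ℝ => |(Δ φ) p.1| * C)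
        (volume.prod (volume.restrict (Set.Ioc 0 ‖z‖))) :=
      (hΔ.norm.integrable_of_hasCompactSupport hΔc.norm).mul_prod (integrable_const C)
    refine hb.mono' ?_ ?_
    · exact ((measurable_greenIntegrand z).comp measurable_swap).aestronglyMeasurable.mul
        (hΔ.comp continuous_fst).aestronglyMeasurable
    · have h1 : ∀ᵐ s ∂(volume.restrict (Set.Ioc 0 ‖z‖)), s ∈ Set.Ioc 0 ‖z‖ :=
        ae_restrict_mem measurableSet_Ioc
      filter_upwards [(Measure.quasiMeasurePreserving_snd
        (μ := (volume : Measure (Space n)))).ae h1] with p hp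
      simp only [Function.uncurry, norm_mul, Real.norm_eq_abs]
      rw [mul_comm]
      by_cases hx : p.1 ∈ ball (0 : Space n) 1
      · exact mul_le_mul_of_nonneg_left (hC _ hp _ (mem_ball_zero_iff.1 hx).le) (abs_nonneg _)
      · rw [laplacian_eq_zero_of_notMem_tsupport fun h => hx (hs h)]
        simp
  have hswap := integral_integral_swap hint
  calc ∫ x, correction n z x * (Δ φ) x
      = ∫ x, ∫ s in Set.Ioc 0 ‖z‖, greenIntegrand n z x s * (Δ φ) x := by
        refine integral_congr_ae (Eventually.of_forall fun x => ?_)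
        simp only [integral_mul_const, correction,
          intervalIntegral.integral_of_le (norm_nonneg z)]
    _ = ∫ s in Set.Ioc 0 ‖z‖, ∫ x, greenIntegrand n z x s * (Δ φ) x := hswap
    _ = ∫ s in Set.Ioc 0 ‖z‖, 0 := setIntegral_congr_fun measurableSet_Ioc fun s hs' =>
        integral_greenIntegrand_mul_laplacian hn hz0 hs'.1 (hs'.2.trans_lt hz) hφ hc hs
    _ = 0 := by simp

/-! ### The function `G_z` solves the problem -/

theorem green_eq (n : ℕ) (z x : Space n) :
    green n z x = fundamentalSolution n (x - z) + 1 / surfaceArea n * correction n z x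
      - 1 / (2 * surfaceArea n) * ‖x‖ ^ 2 := rfl

theorem norm_mul_norm_lt_one {z x : Space n} (hz : z ∈ ball (0 : Space n) 1)
    (hx : x ∈ closedBall (0 : Space n) 1) : ‖z‖ * ‖x‖ < 1 := by
  rw [mem_ball_zero_iff] at hz
  rw [mem_closedBall_zero_iff] at hx
  nlinarith [norm_nonneg z, norm_nonneg x]

theorem contDiffAt_green (hn : 1 ≤ n) {z x : Space n} (hz : z ∈ ball (0 : Space n) 1)
    (hx : x ∈ closedBall (0 : Space n) 1) (hxz : x ≠ z) : ContDiffAt ℝ 1 (green n z) x := by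
  have h1 : ContDiffAt ℝ 1 (fun x => fundamentalSolution n (x - z)) x :=
    ContDiffAt.comp x ((contDiffAt_fundamentalSolution hn (sub_ne_zero.2 hxz)).of_le one_le_two)
      (contDiffAt_id.sub contDiffAt_const)
  have h2 : ContDiffAt ℝ 1 (fun x => 1 / surfaceArea n * correction n z x) x :=
    contDiffAt_const.mul (contDiffAt_correction (norm_mul_norm_lt_one hz hx))
  have h3 : ContDiffAt ℝ 1 (fun x : Space n => 1 / (2 * surfaceArea n) * ‖x‖ ^ 2) x :=
    contDiffAt_const.mul (contDiff_norm_sq ℝ).contDiffAt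
  exact (h1.add h2).sub h3

/-- The reflection identity `||z| x - z/|z|| = |x - z|` on the unit sphere, in terms of `dipole`. -/
theorem dipole_smul_eq {z x : Space n} (hz : z ≠ 0) (hx : ‖x‖ = 1) :
    dipole n (‖z‖⁻¹ • z) (‖z‖ • x) = (⟪x, z⟫ - 1) / ‖x - z‖ ^ n := by
  have hz' : ‖z‖ ≠ 0 := norm_ne_zero_iff.2 hz
  have h1 : ⟪‖z‖ • x, ‖z‖⁻¹ • z⟫ = ⟪x, z⟫ := by
    rw [real_inner_smul_left, real_inner_smul_right, mul_inv_cancel_left₀ hz']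
  have h2 : ‖‖z‖ • x - ‖z‖⁻¹ • z‖ = ‖x - z‖ := by
    rw [← sq_eq_sq₀ (norm_nonneg _) (norm_nonneg _), norm_sub_sq_real, norm_sub_sq_real, h1,
      norm_direction hz, norm_smul, norm_norm, hx]
    ring
  rw [dipole, h1, h2]

theorem hasZeroNeumannData_green (hn : 1 ≤ n) {z : Space n} (hz : z ∈ ball (0 : Space n) 1) :
    HasZeroNeumannData n (green n z) := by
  intro x hx
  have hx1 : ‖x‖ = 1 := mem_sphere_zero_iff_norm.1 hx
  have hxz : x - z ≠ 0 := by
    rw [sub_ne_zero]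
    rintro rfl
    rw [mem_ball_zero_iff] at hz
    linarith
  have hzx := norm_mul_norm_lt_one hz (sphere_subset_closedBall hx)
  have hω := (surfaceArea_pos hn).ne'
  have hp : ‖x - z‖ ^ n ≠ 0 := pow_ne_zero n (norm_ne_zero_iff.2 hxz)
  have d1 : HasFDerivAt (fun x => fundamentalSolution n (x - z))
      ((1 / (surfaceArea n * ‖x - z‖ ^ n)) • innerSL ℝ (x - z)) x := by
    have h := HasFDerivAt.comp (f := fun x => x - z) x (hasFDerivAt_fundamentalSolution hn hxz)
      ((hasFDerivAt_id x).sub_const z)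
    rwa [ContinuousLinearMap.comp_id] at h
  have d2 := (hasFDerivAt_correction (n := n) hzx).const_mul (1 / surfaceArea n)
  have d3 := (hasFDerivAt_comp_norm_sq (x := x) (hasDerivAt_id (‖x‖ ^ 2))).const_mul
    (1 / (2 * surfaceArea n))
  have d := (d1.add d2).sub d3
  set L := (1 / (surfaceArea n * ‖x - z‖ ^ n)) • innerSL ℝ (x - z) +
    (1 / surfaceArea n) • correctionDeriv n z x -
    (1 / (2 * surfaceArea n)) • ((2 * 1 : ℝ) • innerSL ℝ x) with hL
  refine ⟨(InnerProductSpace.toDual ℝ (Space n)).symm L, ?_, ?_⟩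
  · rw [hasGradientWithinAt_iff_hasFDerivWithinAt, LinearIsometryEquiv.apply_symm_apply]
    exact HasFDerivAt.hasFDerivWithinAt d
  · rw [InnerProductSpace.toDual_symm_apply]
    have hLx : L x = 1 / (surfaceArea n * ‖x - z‖ ^ n) * ⟪x - z, x⟫ +
        1 / surfaceArea n * correctionDeriv n z x x - 1 / (2 * surfaceArea n) * (2 * ⟪x, x⟫) := by
      simp [hL, inner_sub_left]
    rw [hLx, inner_sub_left, real_inner_self_eq_norm_sq, hx1]
    by_cases hz0 : z = 0
    · subst hz0
      have : correctionDeriv n (0 : Space n) x = 0 := by simp [correctionDeriv]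
      rw [this, sub_zero, hx1, inner_zero_left]
      simp
    · rw [correctionDeriv_apply_self hz0 hzx, dipole_smul_eq hz0 hx1, real_inner_comm x z]
      field_simp
      ring

theorem locallyIntegrable_translated_fundamentalSolution (hn : 1 ≤ n) (z : Space n) :
    LocallyIntegrable fun x => fundamentalSolution n (x - z) := by
  intro x
  refine ⟨ball z (dist x z + 1), isOpen_ball.mem_nhds (by simp), ?_⟩
  have h := integrableOn_fundamentalSolution hn (dist x z + 1)
  rw [← integrable_indicator_iff measurableSet_ball] at h ⊢
  refine (h.comp_sub_right z).congr (Eventually.of_forall fun y => ?_)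
  simp only [Set.indicator, mem_ball, dist_eq_norm, sub_zero]

theorem laplacian_norm_sq (x : Space n) : (Δ fun y : Space n => ‖y‖ ^ 2) x = (2 * n : ℝ) := by
  have h := laplacian_comp_norm_sq (f := fun t => t) (f' := fun _ => 1) (f'' := 0) (x := x)
    (Eventually.of_forall fun t => hasDerivAt_id t) (hasDerivAt_const _ _)
  simpa using h

theorem locallyIntegrableOn_green (hn : 1 ≤ n) {z : Space n} (hz : z ∈ ball (0 : Space n) 1) :
    LocallyIntegrableOn (green n z) (ball 0 1) := by
  have h1 := (locallyIntegrable_translated_fundamentalSolution hn z).locallyIntegrableOn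
    (ball (0 : Space n) 1)
  have h2 : LocallyIntegrableOn (fun x : Space n => 1 / surfaceArea n * correction n z x
      - 1 / (2 * surfaceArea n) * ‖x‖ ^ 2) (ball 0 1) := by
    refine ContinuousOn.locallyIntegrableOn ?_ measurableSet_ball
    exact (continuousOn_const.mul ((continuousOn_correction hz).mono
      ball_subset_closedBall)).sub (by fun_prop)
  have e : green n z = (fun x => fundamentalSolution n (x - z)) + fun x : Space n =>
      1 / surfaceArea n * correction n z x - 1 / (2 * surfaceArea n) * ‖x‖ ^ 2 := by
    funext x
    rw [green_eq, Pi.add_apply]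
    ring
  rw [e]
  exact h1.add h2

theorem integral_green_mul_laplacian (hn : 1 ≤ n) {z : Space n} (hz : z ∈ ball (0 : Space n) 1)
    {φ : Space n → ℝ} (hφ : ContDiff ℝ 2 φ) (hc : HasCompactSupport φ)
    (hs : tsupport φ ⊆ ball 0 1) :
    ∫ x, green n z x * (Δ φ) x = φ z - n / surfaceArea n * ∫ x, φ x := by
  have i1 := integrable_mul_laplacian
    ((locallyIntegrable_translated_fundamentalSolution hn z).locallyIntegrableOn _) hφ hc hs
  have i2 := integrable_mul_laplacian (((continuousOn_correction hz).mono
    ball_subset_closedBall).locallyIntegrableOn measurableSet_ball) hφ hc hs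
  have i3 := integrable_mul_laplacian (u := fun x : Space n => ‖x‖ ^ 2) (U := ball 0 1)
    (ContinuousOn.locallyIntegrableOn (by fun_prop) measurableSet_ball) hφ hc hs
  have e : ∀ x, green n z x * (Δ φ) x = fundamentalSolution n (x - z) * (Δ φ) x +
      1 / surfaceArea n * (correction n z x * (Δ φ) x) -
      1 / (2 * surfaceArea n) * (‖x‖ ^ 2 * (Δ φ) x) := fun x => by
    rw [green_eq]
    ring
  have i12 : Integrable fun x => fundamentalSolution n (x - z) * (Δ φ) x +
      1 / surfaceArea n * (correction n z x * (Δ φ) x) := i1.add (i2.const_mul _)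
  simp only [e]
  rw [integral_sub i12 (i3.const_mul _), integral_add i1 (i2.const_mul _),
    integral_const_mul, integral_const_mul, integral_fundamentalSolution_mul_laplacian hn hφ hc,
    integral_correction_mul_laplacian hn hz hφ hc hs,
    integral_mul_laplacian_eq (contDiff_norm_sq ℝ) hφ hc]
  simp only [laplacian_norm_sq, integral_const_mul]
  have hω := (surfaceArea_pos hn).ne'
  field_simp
  ring

/-- The weak equation with unbundled test functions and integrals over the whole space. -/
theorem solvesPoisson_iff {z : Space n} {u : Space n → ℝ} :
    SolvesPoisson n z u ↔ LocallyIntegrableOn u (ball 0 1) volume ∧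
      ∀ φ : Space n → ℝ, ContDiff ℝ ∞ φ → HasCompactSupport φ → tsupport φ ⊆ ball 0 1 →
        ∫ x, u x * (Δ φ) x = φ z - n / surfaceArea n * ∫ x, φ x := by
  have key : ∀ φ : Space n → ℝ, tsupport φ ⊆ ball 0 1 →
      (∫ x in ball (0 : Space n) 1, u x * (Δ φ) x = ∫ x, u x * (Δ φ) x) ∧
      ∫ x in ball (0 : Space n) 1, φ x = ∫ x, φ x := by
    intro φ hφ
    refine ⟨setIntegral_eq_integral_of_forall_compl_eq_zero fun x hx => ?_,
      setIntegral_eq_integral_of_forall_compl_eq_zero fun x hx => ?_⟩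
    · rw [laplacian_eq_zero_of_notMem_tsupport fun h => hx (hφ h), mul_zero]
    · exact image_eq_zero_of_notMem_tsupport fun h => hx (hφ h)
  refine and_congr_right fun _ => ⟨fun h φ h1 h2 h3 => ?_, fun h φ => ?_⟩
  · have := h ⟨φ, h1, h2, h3⟩
    rw [← (key φ h3).1, ← (key φ h3).2]
    exact this
  · rw [(key φ φ.tsupport_subset).1, (key φ φ.tsupport_subset).2]
    exact h φ φ.contDiff φ.hasCompactSupport φ.tsupport_subset

theorem solvesPoisson_green (hn : 1 ≤ n) {z : Space n} (hz : z ∈ ball (0 : Space n) 1) :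
    SolvesPoisson n z (green n z) :=
  solvesPoisson_iff.2 ⟨locallyIntegrableOn_green hn hz, fun _ h1 h2 h3 =>
    integral_green_mul_laplacian hn hz (h1.of_le two_le_infty) h2 h3⟩

theorem SolvesPoisson.add_const {z : Space n} {u : Space n → ℝ} (hu : SolvesPoisson n z u)
    (c : ℝ) : SolvesPoisson n z fun x => u x + c := by
  rw [solvesPoisson_iff] at hu ⊢
  have hc : LocallyIntegrableOn (fun _ : Space n => c) (ball 0 1) :=
    continuousOn_const.locallyIntegrableOn measurableSet_ball
  refine ⟨hu.1.add hc, fun φ h1 h2 h3 => ?_⟩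
  have h1' := h1.of_le two_le_infty
  rw [← hu.2 φ h1 h2 h3]
  simp only [add_mul]
  rw [integral_add (integrable_mul_laplacian hu.1 h1' h2 h3)
    (integrable_mul_laplacian hc h1' h2 h3), integral_const_mul, integral_laplacian_eq_zero h1' h2]
  simp

theorem HasZeroNeumannData.add_const {u : Space n → ℝ} (hu : HasZeroNeumannData n u) (c : ℝ) :
    HasZeroNeumannData n fun x => u x + c := by
  intro x hx
  obtain ⟨g, hg, hgx⟩ := hu x hx
  refine ⟨g, ?_, hgx⟩
  rw [hasGradientWithinAt_iff_hasFDerivWithinAt] at hg ⊢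
  exact hg.add_const c

/-! ### Uniqueness -/

/-- A derivative at a boundary point survives when the function is changed on a null set of the ball
so as to become continuous there: the estimate defining the derivative extends by density. -/
theorem hasFDerivWithinAt_of_ae_eq {f F : Space n → ℝ} {L : Space n →L[ℝ] ℝ} {x : Space n}
    (hx : x ∈ sphere (0 : Space n) 1) (hf : HasFDerivWithinAt f L (closedBall 0 1) x)
    (hF : ContinuousOn F (ball 0 1)) (hs : Set.EqOn f F (sphere 0 1))
    (hae : ∀ᵐ y, y ∈ ball (0 : Space n) 1 → f y = F y) :
    HasFDerivWithinAt F L (closedBall 0 1) x := by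
  rw [hasFDerivWithinAt_iff_isLittleO, Asymptotics.isLittleO_iff] at hf ⊢
  intro c hc
  obtain ⟨δ, hδ, h⟩ := Metric.mem_nhdsWithin_iff.1 (hf hc)
  refine Metric.mem_nhdsWithin_iff.2 ⟨δ, hδ, fun y hy => ?_⟩
  rcases eq_or_ne ‖y‖ 1 with h1 | h1
  · have hys : y ∈ sphere (0 : Space n) 1 := mem_sphere_zero_iff_norm.2 h1
    have := h hy
    simp only [Set.mem_ofPred_eq] at this ⊢
    rwa [← hs hys, ← hs hx]
  · have hyb : y ∈ ball (0 : Space n) 1 :=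
      mem_ball_zero_iff.2 (lt_of_le_of_ne (mem_closedBall_zero_iff.1 hy.2) h1)
    -- The estimate, written as an equality of continuous functions, holds almost everywhere and
    -- hence everywhere on an open set.
    have key : Set.EqOn (fun y => max (‖F y - F x - L (y - x)‖ - c * ‖y - x‖) 0) (fun _ => 0)
        (ball x δ ∩ ball 0 1) := by
      refine Measure.eqOn_open_of_ae_eq (μ := (volume : Measure (Space n))) ?_
        (isOpen_ball.inter isOpen_ball) ?_ continuousOn_const
      · rw [EventuallyEq, ae_restrict_iff' (measurableSet_ball.inter measurableSet_ball)]
        filter_upwards [hae] with w hw hwm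
        have := h ⟨hwm.1, ball_subset_closedBall hwm.2⟩
        simp only [Set.mem_ofPred_eq] at this
        rw [← hs hx, ← hw hwm.2]
        exact max_eq_right (by linarith)
      · have hF' : ContinuousOn F (ball x δ ∩ ball 0 1) := hF.mono Set.inter_subset_right
        fun_prop
    have := key ⟨hy.1, hyb⟩
    have := max_eq_right_iff.1 this
    simp only [Set.mem_ofPred_eq]
    linarith

/-- A weakly harmonic function on an annulus is bounded by its boundary values. Among the points
where the maximum is attained, one of largest norm lies on the boundary, since near an interior
maximum the function is constant. -/
theorem WeaklyHarmonicOn.le_of_annulus {f : Space n → ℝ} {a b B : ℝ} (ha : 0 < a)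
    (hf : WeaklyHarmonicOn f {x | a < ‖x‖ ∧ ‖x‖ < b})
    (hfc : ContinuousOn f {x | a ≤ ‖x‖ ∧ ‖x‖ ≤ b})
    (hfa : ∀ x, ‖x‖ = a → f x ≤ B) (hfb : ∀ x, ‖x‖ = b → f x ≤ B) {x : Space n}
    (hax : a ≤ ‖x‖) (hxb : ‖x‖ ≤ b) : f x ≤ B := by
  set A : Set (Space n) := {x | a ≤ ‖x‖ ∧ ‖x‖ ≤ b} with hA
  set U : Set (Space n) := {x | a < ‖x‖ ∧ ‖x‖ < b} with hUdef
  have hAcl : IsClosed A := (isClosed_le continuous_const continuous_norm).inter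
    (isClosed_le continuous_norm continuous_const)
  have hAc : IsCompact A := (isCompact_closedBall (0 : Space n) b).of_isClosed_subset hAcl
    fun y hy => mem_closedBall_zero_iff.2 hy.2
  have hU : IsOpen U := (isOpen_lt continuous_const continuous_norm).inter
    (isOpen_lt continuous_norm continuous_const)
  have hUA : U ⊆ A := fun y hy => ⟨hy.1.le, hy.2.le⟩
  obtain ⟨x₁, hx₁, hmax₁⟩ := hAc.exists_isMaxOn ⟨x, hax, hxb⟩ hfc
  have hK : IsCompact (A ∩ f ⁻¹' {f x₁}) := hAc.of_isClosed_subset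
    (hfc.preimage_isClosed_of_isClosed hAcl isClosed_singleton) Set.inter_subset_left
  obtain ⟨x₂, hx₂, hmax₂⟩ := hK.exists_isMaxOn ⟨x₁, hx₁, rfl⟩ continuous_norm.continuousOn
  have hx₂f : f x₂ = f x₁ := hx₂.2
  refine (hmax₁ (show x ∈ A from ⟨hax, hxb⟩)).trans ?_
  rw [← hx₂f]
  by_contra hB
  have hx₂U : x₂ ∈ U := by
    refine ⟨lt_of_le_of_ne hx₂.1.1 fun h => hB (hfa _ h.symm),
      lt_of_le_of_ne hx₂.1.2 fun h => hB (hfb _ h)⟩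
  obtain ⟨r, hr, hrU⟩ := Metric.nhds_basis_closedBall.mem_iff.1 (hU.mem_nhds hx₂U)
  have hconst := hf.eq_of_le (hfc.mono hUA) hr hrU fun y hy => by
    rw [hx₂f]
    exact hmax₁ (hUA (hrU hy))
  have hn0 : 0 < ‖x₂‖ := ha.trans hx₂U.1
  -- `y` lies in the ball of constancy but has larger norm than `x₂`.
  set y := x₂ + (r / (2 * ‖x₂‖)) • x₂ with hy
  have hyb : y ∈ ball x₂ r := by
    rw [mem_ball, dist_eq_norm, hy, add_sub_cancel_left, norm_smul,
      Real.norm_of_nonneg (by positivity)]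
    field_simp
    linarith
  have hynorm : ‖y‖ = ‖x₂‖ + r / 2 := by
    have : y = (1 + r / (2 * ‖x₂‖)) • x₂ := by
      rw [hy, add_smul, one_smul]
    rw [this, norm_smul, Real.norm_of_nonneg (by positivity)]
    field_simp
  have hle : ‖y‖ ≤ ‖x₂‖ := hmax₂
    ⟨hUA (hrU (ball_subset_closedBall hyb)), (hconst y hyb).trans hx₂f⟩
  linarith

theorem weaklyHarmonicOn_fundamentalSolution (hn : 1 ≤ n) {U : Set (Space n)}
    (hU : (0 : Space n) ∉ U) : WeaklyHarmonicOn (fundamentalSolution n) U := by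
  intro φ h1 h2 h3
  rw [integral_fundamentalSolution_mul_laplacian_zero hn (h1.of_le two_le_infty) h2]
  exact image_eq_zero_of_notMem_tsupport fun h => hU (h3 h)

/-- **Strong maximum principle** on the unit ball. -/
theorem WeaklyHarmonicOn.eqOn_closedBall_of_isMaxOn {f : Space n → ℝ}
    (hf : WeaklyHarmonicOn f (ball 0 1)) (hfc : ContinuousOn f (closedBall 0 1)) {x₀ : Space n}
    (hx₀ : x₀ ∈ ball (0 : Space n) 1) (hmax : IsMaxOn f (closedBall 0 1) x₀) :
    Set.EqOn f (fun _ => f x₀) (closedBall 0 1) := by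
  have hfb : ContinuousOn f (ball 0 1) := hfc.mono ball_subset_closedBall
  set A : Set (Space n) := ball 0 1 ∩ f ⁻¹' {f x₀} with hA
  have hAo : IsOpen A := by
    rw [isOpen_iff_mem_nhds]
    intro x hx
    obtain ⟨r, hr, hrb⟩ := Metric.nhds_basis_closedBall.mem_iff.1 (isOpen_ball.mem_nhds hx.1)
    have hxf : f x = f x₀ := hx.2
    have hconst := hf.eq_of_le hfb hr hrb fun y hy => by
      rw [hxf]
      exact hmax (ball_subset_closedBall (hrb hy))
    exact Filter.mem_of_superset (ball_mem_nhds x hr) fun y hy =>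
      ⟨hrb (ball_subset_closedBall hy), (hconst y hy).trans hxf⟩
  have hsub : ball (0 : Space n) 1 ⊆ A := by
    refine (convex_ball (0 : Space n) 1).isPreconnected.subset_of_closure_inter_subset hAo
      ⟨x₀, hx₀, hx₀, rfl⟩ fun x hx => ⟨hx.2, ?_⟩
    have h1 : ContinuousWithinAt f A x :=
      ((hfb.continuousAt (isOpen_ball.mem_nhds hx.2))).continuousWithinAt
    have : f x ∈ closure {f x₀} := h1.mem_closure hx.1 fun y hy => hy.2
    rwa [closure_singleton] at this
  have heq : Set.EqOn f (fun _ => f x₀) (ball 0 1) := fun x hx => (hsub hx).2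
  refine heq.of_subset_closure hfc continuousOn_const ball_subset_closedBall ?_
  rw [closure_ball _ one_ne_zero]

/-- **Hopf's boundary point lemma** on the unit ball: at a boundary maximum that exceeds all
interior values the outward derivative is nonzero. The barrier is a multiple of the fundamental
solution. -/
theorem WeaklyHarmonicOn.radial_deriv_ne_zero (hn : 1 ≤ n) {f : Space n → ℝ}
    (hf : WeaklyHarmonicOn f (ball 0 1)) (hfc : ContinuousOn f (closedBall 0 1)) {x₀ : Space n}
    (hx₀ : x₀ ∈ sphere (0 : Space n) 1) (hmax : IsMaxOn f (closedBall 0 1) x₀)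
    (hlt : ∀ y ∈ ball (0 : Space n) 1, f y < f x₀) {L : Space n →L[ℝ] ℝ}
    (hL : HasFDerivWithinAt f L (closedBall 0 1) x₀) : L x₀ ≠ 0 := by
  intro hL0
  have hω := surfaceArea_pos hn
  have hx1 : ‖x₀‖ = 1 := mem_sphere_zero_iff_norm.1 hx₀
  have hx0 : x₀ ≠ 0 := norm_pos_iff.1 (by rw [hx1]; exact one_pos)
  have hsub : sphere (0 : Space n) (1 / 2) ⊆ ball 0 1 := sphere_subset_ball (by norm_num)
  have hne : (sphere (0 : Space n) (1 / 2)).Nonempty := ⟨(1 / 2 : ℝ) • x₀, by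
    rw [mem_sphere_zero_iff_norm, norm_smul, hx1]
    norm_num⟩
  obtain ⟨y₀, hy₀, hymax⟩ := (isCompact_sphere (0 : Space n) (1 / 2)).exists_isMaxOn hne
    (hfc.mono (hsub.trans ball_subset_closedBall))
  have hδ : 0 < f x₀ - f y₀ := sub_pos.2 (hlt y₀ (hsub hy₀))
  set p := fundamentalProfile n 1 with hp
  set q := fundamentalProfile n ((1 / 2) ^ 2) with hq
  -- `ε` is small enough that subtracting `ε Φ` keeps the values on the inner sphere below the value
  -- at `x₀`; the `+ 1` keeps the denominator positive.
  set ε := (f x₀ - f y₀) / (|p - q| + 1) with hε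
  have hε0 : 0 < ε := by positivity
  have hεpq : ε * (p - q) ≤ f x₀ - f y₀ := by
    have h1 : p - q ≤ |p - q| + 1 := (le_abs_self _).trans (by linarith)
    calc ε * (p - q) ≤ ε * (|p - q| + 1) := mul_le_mul_of_nonneg_left h1 hε0.le
      _ = f x₀ - f y₀ := by
        rw [hε]
        field_simp
  set A : Set (Space n) := {x | 1 / 2 ≤ ‖x‖ ∧ ‖x‖ ≤ 1} with hA
  set U : Set (Space n) := {x | 1 / 2 < ‖x‖ ∧ ‖x‖ < 1} with hU
  have hAcb : A ⊆ closedBall 0 1 := fun x hx => mem_closedBall_zero_iff.2 hx.2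
  have hUb : U ⊆ ball 0 1 := fun x hx => mem_ball_zero_iff.2 hx.2
  have hUA : U ⊆ A := fun x hx => ⟨hx.1.le, hx.2.le⟩
  have hΦc : ContinuousOn (fundamentalSolution n) A := fun x hx =>
    (continuousAt_fundamentalSolution hn (norm_pos_iff.1 (by linarith [hx.1]))).continuousWithinAt
  have hUm : MeasurableSet U := ((isOpen_lt continuous_const continuous_norm).inter
    (isOpen_lt continuous_norm continuous_const)).measurableSet
  set g : Space n → ℝ := fun x => f x + (-ε) * fundamentalSolution n x with hg
  have hgw : WeaklyHarmonicOn g U := (hf.mono hUb).add_const_mul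
    (weaklyHarmonicOn_fundamentalSolution hn fun h => absurd h.1 (by rw [norm_zero]; norm_num))
    ((hfc.mono (hUA.trans hAcb)).locallyIntegrableOn hUm)
    ((hΦc.mono hUA).locallyIntegrableOn hUm) _
  have hgc : ContinuousOn g A := (hfc.mono hAcb).add (continuousOn_const.mul hΦc)
  have hgx₀ : g x₀ = f x₀ - ε * p := by
    simp only [hg]
    rw [fundamentalSolution_eq_profile hn, hx1, one_pow]
    ring
  have hgle : ∀ x ∈ A, g x ≤ g x₀ := by
    intro x hx
    refine hgw.le_of_annulus (by norm_num) hgc (fun y hy => ?_) (fun y hy => ?_) hx.1 hx.2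
    · have h1 : f y ≤ f y₀ := hymax (mem_sphere_zero_iff_norm.2 hy)
      rw [hgx₀]
      simp only [hg]
      rw [fundamentalSolution_eq_profile hn, hy, ← hq]
      linarith
    · have h1 : f y ≤ f x₀ := hmax (mem_closedBall_zero_iff.2 hy.le)
      rw [hgx₀]
      simp only [hg]
      rw [fundamentalSolution_eq_profile hn, hy, one_pow]
      linarith
  have hd := (hL.mono hAcb).add
    ((hasFDerivAt_fundamentalSolution hn hx0).hasFDerivWithinAt.const_mul (-ε) (s := A))
  -- The direction from `x₀` to the midpoint of the radius stays in the annulus.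
  have hcone : -((1 / 2 : ℝ) • x₀) ∈ posTangentConeAt A x₀ := by
    refine mem_posTangentConeAt_of_segment_subset ?_
    rw [segment_eq_image']
    rintro _ ⟨θ, hθ, rfl⟩
    have e : x₀ + θ • (x₀ + -((1 / 2 : ℝ) • x₀) - x₀) = (1 - θ / 2) • x₀ := by module
    simp only [e]
    have : ‖(1 - θ / 2) • x₀‖ = 1 - θ / 2 := by
      rw [norm_smul, hx1, mul_one, Real.norm_of_nonneg (by linarith [hθ.2])]
    refine ⟨?_, ?_⟩ <;> rw [this] <;> linarith [hθ.1, hθ.2]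
  have hloc : IsLocalMaxOn g A x₀ := IsMaxOn.localize hgle
  have hfin := hloc.hasFDerivWithinAt_nonpos hd hcone
  have hval : (L + (-ε) • (1 / (surfaceArea n * ‖x₀‖ ^ n)) • innerSL ℝ x₀)
      (-((1 / 2 : ℝ) • x₀)) = ε / (2 * surfaceArea n) := by
    rw [map_neg, map_smul]
    simp [hL0, hx1]
    ring
  rw [hval] at hfin
  have : 0 < ε / (2 * surfaceArea n) := by positivity
  linarith

/-- A weakly harmonic function on the ball with vanishing normal derivative is constant. -/
theorem WeaklyHarmonicOn.exists_eq_const (hn : 1 ≤ n) {f : Space n → ℝ}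
    (hf : WeaklyHarmonicOn f (ball 0 1)) (hfc : ContinuousOn f (closedBall 0 1))
    (hd : ∀ x ∈ sphere (0 : Space n) 1, ∃ L : Space n →L[ℝ] ℝ,
      HasFDerivWithinAt f L (closedBall 0 1) x ∧ L x = 0) :
    ∃ c, ∀ x ∈ closedBall (0 : Space n) 1, f x = c := by
  obtain ⟨x₀, hx₀, hmax⟩ := (isCompact_closedBall (0 : Space n) 1).exists_isMaxOn
    ⟨0, by simp⟩ hfc
  refine ⟨f x₀, ?_⟩
  by_cases h : ∃ y ∈ ball (0 : Space n) 1, f x₀ ≤ f y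
  · obtain ⟨y, hy, hle⟩ := h
    have hxy : f y = f x₀ := le_antisymm (hmax (ball_subset_closedBall hy)) hle
    rw [← hxy]
    exact hf.eqOn_closedBall_of_isMaxOn hfc hy fun w hw => by
      rw [Set.mem_ofPred_eq, hxy]
      exact hmax hw
  · push Not at h
    have hx₀s : x₀ ∈ sphere (0 : Space n) 1 := by
      rw [mem_sphere_zero_iff_norm]
      refine le_antisymm (mem_closedBall_zero_iff.1 hx₀) (not_lt.1 fun hlt => ?_)
      exact lt_irrefl _ (h x₀ (mem_ball_zero_iff.2 hlt))
    obtain ⟨L, hL, hL0⟩ := hd x₀ hx₀s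
    exact absurd hL0 (hf.radial_deriv_ne_zero hn hfc hx₀s hmax h hL)

theorem IsNeumannGreen.exists_eq_green_add_const (hn : 1 ≤ n) {z : Space n}
    (hz : z ∈ ball (0 : Space n) 1) {u : Space n → ℝ} (hu : IsNeumannGreen n z u) :
    ∃ c : ℝ, (∀ᵐ x ∂(volume.restrict (ball (0 : Space n) 1)), u x = green n z x + c) ∧
      ∀ x ∈ sphere (0 : Space n) 1, u x = green n z x + c := by
  have hG := solvesPoisson_iff.1 (solvesPoisson_green hn hz)
  have hu1 := solvesPoisson_iff.1 hu.1
  set w : Space n → ℝ := fun x => u x - green n z x with hw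
  have hwi : LocallyIntegrableOn w (ball 0 1) := hu1.1.sub hG.1
  have hww : WeaklyHarmonicOn w (ball 0 1) := by
    intro φ h1 h2 h3
    have h1' := h1.of_le two_le_infty
    simp only [hw, sub_mul]
    rw [integral_sub (integrable_mul_laplacian hu1.1 h1' h2 h3)
      (integrable_mul_laplacian hG.1 h1' h2 h3), hu1.2 φ h1 h2 h3, hG.2 φ h1 h2 h3, sub_self]
  obtain ⟨h, hhc, hhw⟩ := hww.exists_continuousOn isOpen_ball hwi
  classical
  -- The continuous representative inside, the given boundary values on the sphere.
  set W : Space n → ℝ := (ball (0 : Space n) 1).piecewise h w with hW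
  have hWb : Set.EqOn W h (ball 0 1) := Set.piecewise_eqOn _ _ _
  have hWs : Set.EqOn w W (sphere 0 1) := fun x hx => (Set.piecewise_eq_of_notMem _ _ _
    (by simp [mem_sphere_zero_iff_norm.1 hx])).symm
  have hwW : ∀ᵐ x, x ∈ ball (0 : Space n) 1 → w x = W x := by
    filter_upwards [hhw] with x hx hxb
    rw [hx hxb, hWb hxb]
  have hWbc : ContinuousOn W (ball 0 1) := hhc.congr hWb
  have hWd : ∀ x ∈ sphere (0 : Space n) 1, ∃ L : Space n →L[ℝ] ℝ,
      HasFDerivWithinAt W L (closedBall 0 1) x ∧ L x = 0 := by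
    intro x hx
    obtain ⟨g₁, hg₁, ho₁⟩ := hu.2 x hx
    obtain ⟨g₂, hg₂, ho₂⟩ := hasZeroNeumannData_green hn hz x hx
    rw [hasGradientWithinAt_iff_hasFDerivWithinAt] at hg₁ hg₂
    refine ⟨_, hasFDerivWithinAt_of_ae_eq hx (hg₁.sub hg₂) hWbc hWs hwW, ?_⟩
    rw [_root_.sub_apply, InnerProductSpace.toDual_apply_apply,
      InnerProductSpace.toDual_apply_apply, ho₁, ho₂, sub_zero]
  have hWc : ContinuousOn W (closedBall 0 1) := by
    intro x hx
    by_cases hxb : x ∈ ball (0 : Space n) 1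
    · exact (hWbc.continuousAt (isOpen_ball.mem_nhds hxb)).continuousWithinAt
    · rw [mem_ball_zero_iff, not_lt] at hxb
      obtain ⟨L, hL, -⟩ := hWd x (mem_sphere_zero_iff_norm.2
        (le_antisymm (mem_closedBall_zero_iff.1 hx) hxb))
      exact hL.continuousWithinAt
  obtain ⟨c, hc⟩ := (hww.congr_ae hwW).exists_eq_const hn hWc hWd
  refine ⟨c, ?_, fun x hx => ?_⟩
  · rw [ae_restrict_iff' measurableSet_ball]
    filter_upwards [hwW] with x hx hxb
    have := (hx hxb).trans (hc x (ball_subset_closedBall hxb))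
    simp only [hw] at this
    linarith
  · have := (hWs hx).trans (hc x (sphere_subset_closedBall hx))
    simp only [hw] at this
    linarith

end NeumannGreen

theorem mainTheorem1 (n : ℕ) (hn : 1 ≤ n) (z : NeumannGreen.Space n)
    (hz : z ∈ ball (0 : NeumannGreen.Space n) 1) :
    -- the integral in the formula converges for every `x` in the closed ball
    (∀ x ∈ closedBall (0 : NeumannGreen.Space n) 1,
      IntervalIntegrable (NeumannGreen.greenIntegrand n z x) volume 0 ‖z‖) ∧
    -- away from `z`, the function is `C¹` up to the boundary
    ContDiffOn ℝ 1 (NeumannGreen.green n z) (closedBall 0 1 \ {z}) ∧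
    -- it is a solution, and so is each function obtained by adding a constant
    NeumannGreen.IsNeumannGreen n z (NeumannGreen.green n z) ∧
    (∀ c : ℝ, NeumannGreen.IsNeumannGreen n z (fun x => NeumannGreen.green n z x + c)) ∧
    -- there are no other solutions; the constant may depend on `z`
    (∀ u : NeumannGreen.Space n → ℝ, NeumannGreen.IsNeumannGreen n z u →
      ∃ c : ℝ,
        (∀ᵐ x ∂(volume.restrict (ball (0 : NeumannGreen.Space n) 1)),
          u x = NeumannGreen.green n z x + c) ∧
        ∀ x ∈ sphere (0 : NeumannGreen.Space n) 1, u x = NeumannGreen.green n z x + c) := by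
  have hP := NeumannGreen.solvesPoisson_green hn hz
  have hN := NeumannGreen.hasZeroNeumannData_green hn hz
  exact ⟨fun x hx => NeumannGreen.intervalIntegrable_greenIntegrand
      (NeumannGreen.norm_mul_norm_lt_one hz hx),
    fun x hx => (NeumannGreen.contDiffAt_green hn hz hx.1 hx.2).contDiffWithinAt,
    ⟨hP, hN⟩, fun c => ⟨hP.add_const c, hN.add_const c⟩,
    fun _ hu => hu.exists_eq_green_add_const hn hz⟩
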